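/- Let $\mathscr M$ be a bicategory, with composition written $p\circ q$ or $pq$. A functor $F:E\to B$ is a *groupoid fibration* if for every $e\in E$ and $\beta:b\to Fe$ there are $\chi:e'\to e$ in $E$ and an isomorphism $b\cong Fe'$ whose composite with $F\chi$ is $\beta$, and if every morphism of $E$ is cartesian for $F$. A morphism $p:S\to Y$ of $\mathscr M$ is a *groupoid fibration* if $\mathscr M(K,p):\mathscr M(K,S)\to\mathscr M(K,Y)$ is one for every object $K$. A morphism $m:S\to X$ is a *right lifter* if for every $u:K\to X$ there is a right lifting of $u$ through $m$, that is, a morphism $\mathrm{rif}(m,u):K\to S$ with a universal 2-cell $\varpi:m\circ\mathrm{rif}(m,u)\Rightarrow u$: every 2-cell $m\circ x\Rightarrow u$ is $\varpi(m\tau)$ for a unique $\tau:x\Rightarrow\mathrm{rif}(m,u)$. Thus $\mathrm{rif}(m,-)$ is right adjoint to $\mathscr M(K,m)$. A *bipullback* of a cospan $S\xrightarrow{p}Y\xleftarrow{n}T$ is a square $\theta:n\circ\tilde p\cong p\circ\tilde n$ (with $\tilde n:P\to S$, $\tilde p:P\to T$) for which, for every $K$, the canonical functor from $\mathscr M(K,P)$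 to the pseudopullback of $\mathscr M(K,n)$ and $\mathscr M(K,p)$ is an equivalence. A *calibration* of $\mathscr M$ is a class of morphisms, called *neat*, such that: equivalences are neat, and a morphism isomorphic to a neat one is neat; if $p$ is neat, then $p\circ q$ is neat if and only if $q$ is neat; every neat morphism is a groupoid fibration; every cospan $S\xrightarrow{p}Y\xleftarrow{n}T$ with $n$ a right lifter and $p$ neat has a bipullback with $\tilde p$ neat. For a calibrated bicategory $\mathscr M$, the bicategory $\mathrm{Poly}\,\mathscr M$ has the same objects as $\mathscr M$. A morphism $X\to Y$ is a *polynomial* $(m,S,p)$: a span $X\xleftarrow{m}S\xrightarrow{p}Y$ with $m$ a right lifter and $p$ neat. A *polynomial morphism* $(\lambda,h,\rho):(m,S,p)\to(n,T,q)$ consists of a morphism $h:S\to T$, a 2-cell $\lambda:n\circ h\Rightarrow m$ and an invertible 2-cell $\rho:p\cong q\circ h$; a 2-cell $(\lambda,h,\rho)\Rightarrow(\lambda',h',\rho')$ is a 2-cell $\sigma:h\Rightarrow h'$ with $\lambda=\lambda'(n\sigma)$ and $\rho'=(q\sigma)\rho$. The 2-cells $(m,S,p)\to(n,T,q)$ of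 $\mathrm{Poly}\,\mathscr M$ are the path components $\mathbf h=[\lambda,h,\rho]$ of polynomial morphisms under these 2-cells $\sigma$. Identities are identity spans. The composite of $(m,S,p):X\to Y$ and $(n,T,q):Y\to Z$ is $(m\tilde n,P,q\tilde p)$, for a chosen bipullback of $p$ and $n$ as above. The horizontal composite of $[\lambda_h,h,\rho_h]:(m,S,p)\to(m',S',p')$ and $[\lambda_k,k,\rho_k]:(n,T,q)\to(n',T',q')$ is represented by the morphism $\ell:P\to P'$, with its 2-cells $\tilde n'\ell\Rightarrow h\tilde n$ and $k\tilde p\cong\tilde p'\ell$, obtained by factoring the 2-cell $n'k\tilde p\Rightarrow n\tilde p\cong p\tilde n\cong p'h\tilde n$ (given by $\lambda_k$, $\theta$, $\rho_h$) through the bipullback $P'$ of $p'$ and $n'$. **Theorem.** Let $\mathscr M$ be a calibrated bicategory and $K$ an object of $\mathscr M$. (1) There is a pseudofunctor $\mathbb H_K:\mathrm{Poly}\,\mathscr M\to\mathrm{Cat}$ with $\mathbb H_KX=\mathscr M(K,X)$, taking a polynomial $X\xleftarrow{m}S\xrightarrow{p}Y$ to the composite functor $$\mathscr M(K,X)\xrightarrow{\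 \mathrm{rif}(m,-)\ }\mathscr M(K,S)\xrightarrow{\ \mathscr M(K,p)\ }\mathscr M(K,Y),$$ and taking a 2-cell $[\lambda,h,\rho]:(m,S,p)\to(n,T,q)$ to the natural transformation (independent of the representative) with components $$p\circ\mathrm{rif}(m,u)\xrightarrow{\ \rho\,\mathrm{rif}(m,u)\ }q\circ h\circ\mathrm{rif}(m,u)\xrightarrow{\ q\hat\lambda_u\ }q\circ\mathrm{rif}(n,u),$$ where $\hat\lambda:\mathscr M(K,h)\,\mathrm{rif}(m,-)\Rightarrow\mathrm{rif}(n,-)$ is the mate, under the adjunctions $\mathscr M(K,m)\dashv\mathrm{rif}(m,-)$ and $\mathscr M(K,n)\dashv\mathrm{rif}(n,-)$, of $\mathscr M(K,\lambda):\mathscr M(K,n)\mathscr M(K,h)\Rightarrow\mathscr M(K,m)$. (2) Let $\mathscr V_K=\mathscr M(K,K)$, a monoidal category under composition, and let $\mathscr V_K\text{-}\mathrm{Act}$ be the 2-category of categories with a right $\mathscr V_K$-action, functors $F$ with coherent natural transformations $F(u)\cdot a\Rightarrow F(u\cdot a)$ (not necessarily invertible), and natural transformations compatible with these. Each $\mathscr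 M(K,X)$ is an object of $\mathscr V_K\text{-}\mathrm{Act}$ by composition. The 2-cells $p\circ\mathrm{rif}(m,u)\circ a\Rightarrow p\circ\mathrm{rif}(m,u\circ a)$, obtained by whiskering with $p$ the 2-cells $\mathrm{rif}(m,u)\circ a\Rightarrow\mathrm{rif}(m,u\circ a)$ induced by $\varpi a:m\circ\mathrm{rif}(m,u)\circ a\Rightarrow u\circ a$, make each functor $\mathbb H_K(m,S,p)$ a morphism of $\mathscr V_K\text{-}\mathrm{Act}$. With these structures $\mathbb H_K$ lifts along the forgetful pseudofunctor $\mathscr V_K\text{-}\mathrm{Act}\to\mathrm{Cat}$ to a pseudofunctor $\mathrm{Poly}\,\mathscr M\to\mathscr V_K\text{-}\mathrm{Act}$. -/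

import Mathlib

open CategoryTheory Bicategory Limits

universe w v u v₁ v₂ u₁ u₂

namespace CalibratedBicategory

/-- A functor `F : C ⥤ D` is a *groupoid fibration* when every `β : b ⟶ F e` is, up to an
isomorphism `b ≅ F e'`, the image of some `χ : e' ⟶ e`, and every morphism of `C` is cartesian. -/
structure IsGroupoidFibrationFunctor {C : Type u₁} [Category.{v₁} C] {D : Type u₂}
    [Category.{v₂} D] (F : C ⥤ D) : Prop where
  exists_lift {e : C} {b : D} (β : b ⟶ F.obj e) :
    ∃ (e' : C) (χ : e' ⟶ e) (i : b ≅ F.obj e'), i.hom ≫ F.map χ = β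
  cartesian {e' e k : C} (χ : e' ⟶ e) (f : k ⟶ e) (g : F.obj k ⟶ F.obj e')
    (hg : g ≫ F.map χ = F.map f) : ∃! l : k ⟶ e', l ≫ χ = f ∧ F.map l = g

theorem IsGroupoidFibrationFunctor.isIso_of_isIso_map {C : Type u₁} [Category.{v₁} C] {D : Type u₂}
    [Category.{v₂} D] {F : C ⥤ D} (hF : IsGroupoidFibrationFunctor F) {x y : C} (f : x ⟶ y)
    [IsIso (F.map f)] : IsIso f := by
  obtain ⟨l, ⟨h₁, h₂⟩, -⟩ := hF.cartesian f (𝟙 y) (inv (F.map f)) (by simp)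
  obtain ⟨_, _, h₄⟩ := hF.cartesian f f (𝟙 _) (by simp)
  refine ⟨l, ?_, h₁⟩
  rw [h₄ (f ≫ l) ⟨by simp [h₁], by simp [h₂]⟩, h₄ (𝟙 x) ⟨by simp, by simp⟩]

section Basic

variable {M : Type u} [Bicategory.{w, v} M]

/-- A morphism `p : E ⟶ B` of a bicategory is a *groupoid fibration* when each functor
`M(K, p) : M(K, E) ⥤ M(K, B)` is one. -/
def IsGroupoidFibration {E B : M} (p : E ⟶ B) : Prop :=
  ∀ K : M, IsGroupoidFibrationFunctor (postcomp K p)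

/-- A morphism `n : Y ⟶ Z` is a *right lifter* when every `u : K ⟶ Z` has a right lifting
through `n`. -/
def IsRightLifter {Y Z : M} (n : Y ⟶ Z) : Prop :=
  ∀ ⦃K : M⦄ (u : K ⟶ Z), ∃ t : RightLift n u, Nonempty t.IsKan

/-- A square with an invertible 2-cell on the cospan of `n : A ⟶ C` and `p : B ⟶ C`. -/
structure IsoSquare {A B C : M} (n : A ⟶ C) (p : B ⟶ C) where
  /-- the vertex of the square -/
  pt : M
  /-- the projection to `A` -/
  fst : pt ⟶ A
  /-- the projection to `B` -/
  snd : pt ⟶ B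
  /-- the invertible 2-cell in the square -/
  iso : fst ≫ n ≅ snd ≫ p

namespace IsoSquare

variable {A B C : M} {n : A ⟶ C} {p : B ⟶ C} (s : IsoSquare n p)

/-- The 2-cell of the square, precomposed with `x : K ⟶ s.pt`. -/
def cmp {K : M} (x : K ⟶ s.pt) : (x ≫ s.fst) ≫ n ≅ (x ≫ s.snd) ≫ p :=
  α_ x s.fst n ≪≫ whiskerLeftIso x s.iso ≪≫ (α_ x s.snd p).symm

theorem cmp_hom {K : M} (x : K ⟶ s.pt) :
    (s.cmp x).hom = (α_ x s.fst n).hom ≫ x ◁ s.iso.hom ≫ (α_ x s.snd p).inv := rfl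

theorem cmp_naturality {K : M} {x y : K ⟶ s.pt} (η : x ⟶ y) :
    (η ▷ s.fst) ▷ n ≫ (s.cmp y).hom = (s.cmp x).hom ≫ (η ▷ s.snd) ▷ p := by
  simp only [cmp_hom, Category.assoc]
  rw [associator_naturality_left_assoc, ← whisker_exchange_assoc, associator_inv_naturality_left]

/-- The functor from `M(K, s.pt)` to the pseudopullback of `M(K, n)` and `M(K, p)`. -/
def toPseudopullback (K : M) :
    (K ⟶ s.pt) ⥤ CategoricalPullback (postcomp K n) (postcomp K p) where
  obj x := { fst := x ≫ s.fst, snd := x ≫ s.snd, iso := s.cmp x }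
  map η := { fst := η ▷ s.fst, snd := η ▷ s.snd, w := s.cmp_naturality η }
  map_id x := by ext <;> simp
  map_comp f g := by ext <;> simp

/-- The square is a *bipullback* when `M(K, s.pt)` is equivalent, through the canonical functor,
to the pseudopullback of `M(K, n)` and `M(K, p)`, for all `K`. -/
def IsBipullback : Prop := ∀ K : M, (s.toPseudopullback K).IsEquivalence

variable {s}

theorem IsBipullback.exists_lift (hs : s.IsBipullback) {K : M} {a : K ⟶ A} {b : K ⟶ B}
    (i : a ≫ n ≅ b ≫ p) :
    ∃ (x : K ⟶ s.pt) (τ : a ≅ x ≫ s.fst) (ω : x ≫ s.snd ≅ b),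
      τ.hom ▷ n ≫ (s.cmp x).hom ≫ ω.hom ▷ p = i.hom := by
  have := hs K
  let y : CategoricalPullback (postcomp K n) (postcomp K p) := ⟨a, b, i⟩
  let x := (s.toPseudopullback K).objPreimage y
  let e : (s.toPseudopullback K).obj x ≅ y := (s.toPseudopullback K).objObjPreimageIso y
  refine ⟨x, (CategoricalPullback.π₁ _ _).mapIso e.symm,
    (CategoricalPullback.π₂ _ _).mapIso e, ?_⟩
  have h := e.hom.w
  change e.inv.fst ▷ n ≫ (s.cmp x).hom ≫ e.hom.snd ▷ p = i.hom
  change e.hom.fst ▷ n ≫ i.hom = (s.cmp x).hom ≫ e.hom.snd ▷ p at h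
  have h' : e.inv.fst ▷ n ≫ e.hom.fst ▷ n = 𝟙 (a ≫ n) := by
    rw [← comp_whiskerRight]
    have := congrArg CategoricalPullback.Hom.fst e.inv_hom_id
    exact (congrArg (· ▷ n) this).trans (id_whiskerRight _ _)
  calc _ = e.inv.fst ▷ n ≫ e.hom.fst ▷ n ≫ i.hom := congrArg (e.inv.fst ▷ n ≫ ·) h.symm
    _ = (e.inv.fst ▷ n ≫ e.hom.fst ▷ n) ≫ i.hom := (Category.assoc _ _ _).symm
    _ = 𝟙 (a ≫ n) ≫ i.hom := congrArg (· ≫ i.hom) h'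
    _ = i.hom := Category.id_comp _

theorem IsBipullback.exists_hom (hs : s.IsBipullback) {K : M} {x y : K ⟶ s.pt}
    (a : x ≫ s.fst ⟶ y ≫ s.fst) (b : x ≫ s.snd ⟶ y ≫ s.snd)
    (w : a ▷ n ≫ (s.cmp y).hom = (s.cmp x).hom ≫ b ▷ p) :
    ∃ η : x ⟶ y, η ▷ s.fst = a ∧ η ▷ s.snd = b := by
  have := hs K
  let f : (s.toPseudopullback K).obj x ⟶ (s.toPseudopullback K).obj y := ⟨a, b, w⟩
  refine ⟨(s.toPseudopullback K).preimage f, ?_, ?_⟩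
  · exact congrArg CategoricalPullback.Hom.fst ((s.toPseudopullback K).map_preimage f)
  · exact congrArg CategoricalPullback.Hom.snd ((s.toPseudopullback K).map_preimage f)

theorem IsBipullback.hom_ext (hs : s.IsBipullback) {K : M} {x y : K ⟶ s.pt} {η θ : x ⟶ y}
    (h₁ : η ▷ s.fst = θ ▷ s.fst) (h₂ : η ▷ s.snd = θ ▷ s.snd) : η = θ := by
  have := hs K
  exact (s.toPseudopullback K).map_injective (CategoricalPullback.hom_ext h₁ h₂)

end IsoSquare

theorem isRightLifter_of_forall {Y Z : M} {n : Y ⟶ Z}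
    (h : ∀ ⦃K : M⦄ (u : K ⟶ Z), ∃ (r : K ⟶ Y) (κ : r ≫ n ⟶ u),
      ∀ (x : K ⟶ Y) (ξ : x ≫ n ⟶ u), ∃! τ : x ⟶ r, τ ▷ n ≫ κ = ξ) : IsRightLifter n := by
  intro K u
  obtain ⟨r, κ, hr⟩ := h u
  refine ⟨RightLift.mk r κ, ⟨RightLift.IsKan.mk
    (fun s => RightLift.homMk (hr s.lift s.counit).choose (hr s.lift s.counit).choose_spec.1)
    (fun s τ => ?_)⟩⟩
  ext
  exact (hr s.lift s.counit).choose_spec.2 _ (RightLift.w τ)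

theorem isRightLifter_id (X : M) : IsRightLifter (𝟙 X) :=
  isRightLifter_of_forall fun _ u => ⟨u, (ρ_ u).hom, fun x ξ =>
    ⟨(ρ_ x).inv ≫ ξ, by simp, fun τ hτ => by simp at hτ; simp [← hτ]⟩⟩

theorem IsRightLifter.exists_unique {Y Z : M} {n : Y ⟶ Z} (hn : IsRightLifter n) {K : M}
    (u : K ⟶ Z) : ∃ (r : K ⟶ Y) (κ : r ≫ n ⟶ u),
      ∀ (x : K ⟶ Y) (ξ : x ≫ n ⟶ u), ∃! τ : x ⟶ r, τ ▷ n ≫ κ = ξ := by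
  obtain ⟨t, ⟨ht⟩⟩ := hn u
  refine ⟨t.lift, t.counit, fun x ξ => ⟨ht.desc (RightLift.mk x ξ), ?_, fun τ hτ => ?_⟩⟩
  · exact ht.fac (RightLift.mk x ξ)
  · apply ht.hom_ext
    rw [hτ]
    exact (ht.fac (RightLift.mk x ξ)).symm

theorem IsRightLifter.comp {X Y Z : M} {f : X ⟶ Y} {g : Y ⟶ Z} (hf : IsRightLifter f)
    (hg : IsRightLifter g) : IsRightLifter (f ≫ g) := by
  refine isRightLifter_of_forall fun K u => ?_
  obtain ⟨r, κ, hr⟩ := hg.exists_unique u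
  obtain ⟨r', κ', hr'⟩ := hf.exists_unique r
  refine ⟨r', (α_ r' f g).inv ≫ κ' ▷ g ≫ κ, fun x ξ => ?_⟩
  obtain ⟨a, ha, ha'⟩ := hr (x ≫ f) ((α_ x f g).hom ≫ ξ)
  obtain ⟨b, hb, hb'⟩ := hr' x a
  refine ⟨b, ?_, fun c hc => ?_⟩
  · simp only at ha hb ⊢
    rw [associator_inv_naturality_left_assoc, ← comp_whiskerRight_assoc, hb, ha]
    simp
  · refine hb' c (ha' _ ?_)
    simp only at hc ⊢
    rw [← hc, associator_inv_naturality_left_assoc]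
    simp

theorem IsoSquare.IsBipullback.isRightLifter_snd {A B C : M} {n : A ⟶ C} {p : B ⟶ C}
    {s : IsoSquare n p} (hs : s.IsBipullback) (hn : IsRightLifter n)
    (hp : IsGroupoidFibration p) : IsRightLifter s.snd := by
  refine isRightLifter_of_forall fun K b => ?_
  obtain ⟨r, κ, hr⟩ := hn.exists_unique (b ≫ p)
  obtain ⟨(w : K ⟶ B), (χ : w ⟶ b), (i : r ≫ n ≅ w ≫ p), (hi : i.hom ≫ χ ▷ p = κ)⟩ :=
    (hp K).exists_lift (e := b) κ
  obtain ⟨z, τ, ω, hz⟩ := hs.exists_lift i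
  refine ⟨z, ω.hom ≫ χ, fun x ξ => ?_⟩
  obtain ⟨a, ha, ha'⟩ := hr (x ≫ s.fst) ((s.cmp x).hom ≫ ξ ▷ p)
  obtain ⟨l, ⟨hl₁, (hl₂ : l ▷ p = (s.cmp x).inv ≫ a ▷ n ≫ i.hom)⟩, hl₃⟩ :=
    (hp K).cartesian χ ξ ((s.cmp x).inv ≫ a ▷ n ≫ i.hom) (by
      change ((s.cmp x).inv ≫ a ▷ n ≫ i.hom) ≫ χ ▷ p = ξ ▷ p
      simp [hi, ha])
  obtain ⟨η, hη₁, hη₂⟩ := hs.exists_hom (x := x) (y := z) (a ≫ τ.hom) (l ≫ ω.inv) (by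
    rw [comp_whiskerRight, comp_whiskerRight, hl₂, ← hz]
    simp)
  refine ⟨η, ?_, fun θ hθ => ?_⟩
  · simp [hη₂, hl₁]
  · simp only at hθ
    have key : (θ ▷ s.fst ≫ τ.inv) ▷ n ≫ i.hom = (s.cmp x).hom ≫ (θ ▷ s.snd ≫ ω.hom) ▷ p := by
      have := s.cmp_naturality θ
      rw [← hz]
      simp only [comp_whiskerRight, Category.assoc, inv_hom_whiskerRight_assoc]
      rw [← Category.assoc, this, Category.assoc]
    have h₁ : θ ▷ s.fst ≫ τ.inv = a := ha' _ (by
      simp only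
      rw [← hi, ← Category.assoc, key, Category.assoc, ← comp_whiskerRight, Category.assoc, hθ])
    have h₂ : θ ▷ s.snd ≫ ω.hom = l := hl₃ _ ⟨by simpa using hθ, by
      have h₃ := (Iso.eq_inv_comp (s.cmp x)).2 key.symm
      rw [h₁] at h₃
      exact h₃⟩
    apply hs.hom_ext
    · rw [hη₁, ← h₁]; simp
    · rw [hη₂, ← h₂]; simp

end Basic

/-- A *calibration* of a bicategory: a class of *neat* morphisms such that
equivalences are neat and neatness is invariant under invertible 2-cells; for neat `p`,
`p ∘ q` is neat if and only if `q` is; neat morphisms are groupoid fibrations; and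
every cospan of a right lifter `n` and a neat `p` has a bipullback in which the projection
opposite to `p` is neat. -/
structure Calibration (M : Type u) [Bicategory.{w, v} M] where
  neat : ∀ ⦃X Y : M⦄, (X ⟶ Y) → Prop
  neat_of_equivalence : ∀ {X Y : M} (e : X ≌ Y), neat e.hom
  neat_of_iso : ∀ {X Y : M} {p q : X ⟶ Y}, neat p → (p ≅ q) → neat q
  neat_comp_iff : ∀ {X Y Z : M} (q : X ⟶ Y) {p : Y ⟶ Z}, neat p → (neat (q ≫ p) ↔ neat q)
  isGroupoidFibration : ∀ {X Y : M} {p : X ⟶ Y}, neat p → IsGroupoidFibration p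
  exists_isBipullback : ∀ {S T Y : M} {p : S ⟶ Y} {n : T ⟶ Y}, neat p → IsRightLifter n →
    ∃ s : IsoSquare n p, s.IsBipullback ∧ neat s.fst

section Spans

variable {M : Type u} [Bicategory.{w, v} M] {X Y : M}

/-- A morphism `(λ, h, ρ) : (m, S, p) ⟶ (m', S', p')` of spans from `X` to `Y`, with
`λ : m' ∘ h ⟶ m` an arbitrary 2-cell and `ρ : p ≅ p' ∘ h` an invertible one. -/
structure SpanHom {S S' : M} (m : S ⟶ X) (p : S ⟶ Y) (m' : S' ⟶ X) (p' : S' ⟶ Y) where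
  h : S ⟶ S'
  lam : h ≫ m' ⟶ m
  rho : p ≅ h ≫ p'

namespace SpanHom

variable {S : M} {m : S ⟶ X} {p : S ⟶ Y} {S' : M} {m' : S' ⟶ X} {p' : S' ⟶ Y}
  {S₂ : M} {m₂ : S₂ ⟶ X} {p₂ : S₂ ⟶ Y} {S₃ : M} {m₃ : S₃ ⟶ X} {p₃ : S₃ ⟶ Y}

/-- A 2-cell between morphisms of spans is a 2-cell `σ : f.h ⟶ g.h` compatible with the `λ` and
`ρ` components. -/
structure Cell (f g : SpanHom m p m' p') where
  σ : f.h ⟶ g.h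
  lam : σ ▷ m' ≫ g.lam = f.lam
  rho : f.rho.hom ≫ σ ▷ p' = g.rho.hom

variable (m p m' p') in
/-- The set of (undirected) path components of the category whose objects are the morphisms
`(m, S, p) ⟶ (m', S', p')` of spans and whose morphisms are the 2-cells between them. -/
def Cls : Type (max v w) := Quot fun f g : SpanHom m p m' p' => Nonempty (Cell f g)

/-- The path component of a morphism of spans. -/
def cls (f : SpanHom m p m' p') : Cls m p m' p' := Quot.mk _ f

theorem cls_eq {f g : SpanHom m p m' p'} (σ : f.h ⟶ g.h) (h₁ : σ ▷ m' ≫ g.lam = f.lam)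
    (h₂ : f.rho.hom ≫ σ ▷ p' = g.rho.hom) : f.cls = g.cls :=
  Quot.sound ⟨⟨σ, h₁, h₂⟩⟩

variable (m p) in
/-- The identity morphism of a span. -/
abbrev id : SpanHom m p m p := ⟨𝟙 _, (λ_ _).hom, (λ_ _).symm⟩

/-- Composition of morphisms of spans. -/
abbrev comp (f : SpanHom m p m' p') (g : SpanHom m' p' m₂ p₂) : SpanHom m p m₂ p₂ where
  h := f.h ≫ g.h
  lam := (α_ _ _ _).hom ≫ f.h ◁ g.lam ≫ f.lam
  rho := f.rho ≪≫ whiskerLeftIso f.h g.rho ≪≫ (α_ _ _ _).symm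

/-- Composition of path components of morphisms of spans. -/
def Cls.comp : Cls m p m' p' → Cls m' p' m₂ p₂ → Cls m p m₂ p₂ :=
  Quot.lift₂ (fun f g => (SpanHom.comp f g).cls)
    (by
      rintro f g g' ⟨σ, h₁, h₂⟩
      refine cls_eq (f.h ◁ σ) ?_ ?_
      · simp [SpanHom.comp, ← h₁]
      · simp [SpanHom.comp, ← h₂])
    (by
      rintro f f' g ⟨σ, h₁, h₂⟩
      refine cls_eq (σ ▷ g.h) ?_ ?_
      · simp [SpanHom.comp, ← h₁, whisker_exchange_assoc]
      · simp only [SpanHom.comp, ← h₂, Iso.trans_hom, whiskerLeftIso_hom, Iso.symm_hom,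
          Category.assoc]
        rw [← associator_inv_naturality_left, whisker_exchange_assoc])

theorem cls_comp (f : SpanHom m p m' p') (g : SpanHom m' p' m₂ p₂) :
    f.cls.comp g.cls = (f.comp g).cls := rfl

theorem Cls.id_comp (f : Cls m p m' p') : (SpanHom.id m p).cls.comp f = f := by
  obtain ⟨f⟩ := f
  refine cls_eq (λ_ _).hom ?_ ?_ <;> simp

theorem Cls.comp_id (f : Cls m p m' p') : f.comp (SpanHom.id m' p').cls = f := by
  obtain ⟨f⟩ := f
  refine cls_eq (ρ_ _).hom ?_ ?_ <;> simp

theorem Cls.assoc (f : Cls m p m' p') (g : Cls m' p' m₂ p₂) (k : Cls m₂ p₂ m₃ p₃) :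
    (f.comp g).comp k = f.comp (g.comp k) := by
  obtain ⟨f⟩ := f
  obtain ⟨g⟩ := g
  obtain ⟨k⟩ := k
  refine cls_eq (α_ _ _ _).hom ?_ ?_ <;> simp

end SpanHom

end Spans

section Pairing

variable {M : Type u} [Bicategory.{w, v} M] {X Y Z S T : M} {m : S ⟶ X} {p : S ⟶ Y}
  {n : T ⟶ Y} {q : T ⟶ Z}

variable (m) in
/-- The first projection of the composite of spans `(m, S, p)` and `(n, T, q)`. -/
abbrev SpanHom.π₁ (s : IsoSquare n p) : SpanHom (s.snd ≫ m) (s.snd ≫ p) m p :=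
  ⟨s.snd, 𝟙 _, Iso.refl _⟩

variable (q) in
/-- The second projection of the composite of spans `(m, S, p)` and `(n, T, q)`. -/
abbrev SpanHom.π₂ (s : IsoSquare n p) : SpanHom (s.snd ≫ p) (s.fst ≫ q) n q :=
  ⟨s.fst, s.iso.hom, Iso.refl _⟩

/-- Given `d = (λ_d, h_d, ρ_d)` into `P` and `e = (λ_e, h_e, ρ_e)` into `Q`, which meet in the
2-cell `ψ = ρ_d λ_e : n ∘ h_e ⟶ p ∘ h_d`, the morphism `f` into the composite of `P` and `Q` is
obtained from a factorization `(σ, h_f, τ)` of `ψ` through the square. -/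
def IsPair (s : IsoSquare n p) {K : M} {a : K ⟶ X} {b : K ⟶ Y} {c : K ⟶ Z}
    (f : SpanHom a c (s.snd ≫ m) (s.fst ≫ q)) (e : SpanHom b c n q)
    (d : SpanHom a b m p) : Prop :=
  ∃ (σ : f.h ≫ s.snd ⟶ d.h) (τ : e.h ≅ f.h ≫ s.fst),
    τ.hom ▷ n ≫ (s.cmp f.h).hom ≫ σ ▷ p = e.lam ≫ d.rho.hom ∧
    f.lam = (α_ f.h s.snd m).inv ≫ σ ▷ m ≫ d.lam ∧
    f.rho.hom = e.rho.hom ≫ τ.hom ▷ q ≫ (α_ f.h s.fst q).hom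

variable {s : IsoSquare n p} {K : M} {a : K ⟶ X} {b : K ⟶ Y} {c : K ⟶ Z}

theorem IsPair.exists (hs : s.IsBipullback) (hP : IsGroupoidFibration p)
    (e : SpanHom b c n q) (d : SpanHom a b m p) :
    ∃ f : SpanHom a c (s.snd ≫ m) (s.fst ≫ q), IsPair s f e d := by
  obtain ⟨(y : K ⟶ S), (χ : y ⟶ d.h), (i : e.h ≫ n ≅ y ≫ p),
    (hi : i.hom ≫ χ ▷ p = e.lam ≫ d.rho.hom)⟩ :=
    (hP K).exists_lift (e := d.h) (e.lam ≫ d.rho.hom)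
  obtain ⟨x, τ, ω, hx⟩ := hs.exists_lift i
  refine ⟨⟨x, (α_ x s.snd m).inv ≫ (ω.hom ≫ χ) ▷ m ≫ d.lam,
    e.rho ≪≫ whiskerRightIso τ q ≪≫ α_ x s.fst q⟩, ω.hom ≫ χ, τ, ?_, rfl, rfl⟩
  rw [← hi, ← hx]
  simp only [comp_whiskerRight, Category.assoc]

theorem IsPair.cls_eq (hs : s.IsBipullback) (hP : IsGroupoidFibration p)
    {f f' : SpanHom a c (s.snd ≫ m) (s.fst ≫ q)} {e : SpanHom b c n q}
    {d : SpanHom a b m p} (h : IsPair s f e d) (h' : IsPair s f' e d) : f.cls = f'.cls := by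
  obtain ⟨σ, τ, h₁, h₂, h₃⟩ := h
  obtain ⟨σ', τ', h₁', h₂', h₃'⟩ := h'
  obtain ⟨l, ⟨hl, (hl' : l ▷ p = (s.cmp f.h).inv ≫ (τ.inv ≫ τ'.hom) ▷ n ≫
    (s.cmp f'.h).hom)⟩, -⟩ := (hP K).cartesian σ' σ
      ((s.cmp f.h).inv ≫ (τ.inv ≫ τ'.hom) ▷ n ≫ (s.cmp f'.h).hom) (by
      change ((s.cmp f.h).inv ≫ (τ.inv ≫ τ'.hom) ▷ n ≫ (s.cmp f'.h).hom) ≫ σ' ▷ p = σ ▷ p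
      rw [comp_whiskerRight, Category.assoc, Category.assoc, Category.assoc, h₁', ← h₁]
      simp)
  obtain ⟨η, hη₁, hη₂⟩ := hs.exists_hom (x := f.h) (y := f'.h) (τ.inv ≫ τ'.hom) l (by
    rw [hl', Iso.hom_inv_id_assoc])
  refine SpanHom.cls_eq η ?_ ?_
  · rw [h₂, h₂', ← hl, associator_inv_naturality_left_assoc, hη₂]
    simp
  · rw [h₃, h₃', Category.assoc, Category.assoc, ← associator_naturality_left, hη₁]
    simp

theorem IsPair.congr_left (hQ : IsGroupoidFibration q)
    {f : SpanHom a c (s.snd ≫ m) (s.fst ≫ q)} {e e' : SpanHom b c n q}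
    {d : SpanHom a b m p} (h : IsPair s f e d) (κ : SpanHom.Cell e e') : IsPair s f e' d := by
  obtain ⟨σ, τ, h₁, h₂, h₃⟩ := h
  have hκ : κ.σ ▷ q = e.rho.inv ≫ e'.rho.hom := by rw [← κ.rho]; simp
  have : IsIso ((postcomp K q).map κ.σ) := by
    change IsIso (κ.σ ▷ q)
    rw [hκ]; infer_instance
  have := (hQ K).isIso_of_isIso_map κ.σ
  refine ⟨σ, (asIso κ.σ).symm ≪≫ τ, ?_, h₂, ?_⟩
  · rw [Iso.trans_hom, comp_whiskerRight, Category.assoc, h₁, ← κ.lam]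
    simp
  · rw [h₃, ← κ.rho]
    simp

theorem IsPair.congr_right
    {f : SpanHom a c (s.snd ≫ m) (s.fst ≫ q)} {e : SpanHom b c n q}
    {d d' : SpanHom a b m p} (h : IsPair s f e d) (κ : SpanHom.Cell d d') : IsPair s f e d' := by
  obtain ⟨σ, τ, h₁, h₂, h₃⟩ := h
  refine ⟨σ ≫ κ.σ, τ, ?_, ?_, h₃⟩
  · rw [← κ.rho, comp_whiskerRight, ← reassoc_of% h₁]
  · rw [h₂, ← κ.lam, comp_whiskerRight, Category.assoc]

/-- The class of morphisms into the composite of `P` and `Q` determined by a pair of classes of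
morphisms into `Q` and into `P`. -/
noncomputable def pair (hs : s.IsBipullback) (hP : IsGroupoidFibration p)
    (hQ : IsGroupoidFibration q) (e : SpanHom.Cls b c n q) (d : SpanHom.Cls a b m p) :
    SpanHom.Cls a c (s.snd ≫ m) (s.fst ≫ q) :=
  Quot.lift₂ (fun e d => (IsPair.exists hs hP e d).choose.cls)
    (fun e d d' ⟨κ⟩ => IsPair.cls_eq hs hP
      ((IsPair.exists hs hP e d).choose_spec.congr_right κ) (IsPair.exists hs hP e d').choose_spec)
    (fun e e' d ⟨κ⟩ => IsPair.cls_eq hs hP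
      ((IsPair.exists hs hP e d).choose_spec.congr_left hQ κ)
      (IsPair.exists hs hP e' d).choose_spec)
    e d

theorem IsPair.pair_eq {hs : s.IsBipullback} {hP : IsGroupoidFibration p}
    {hQ : IsGroupoidFibration q} {f : SpanHom a c (s.snd ≫ m) (s.fst ≫ q)}
    {e : SpanHom b c n q} {d : SpanHom a b m p} (h : IsPair s f e d) :
    pair hs hP hQ e.cls d.cls = f.cls :=
  IsPair.cls_eq hs hP (IsPair.exists hs hP e d).choose_spec h

theorem exists_pair_eq (hs : s.IsBipullback) (hP : IsGroupoidFibration p)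
    (hQ : IsGroupoidFibration q) (e : SpanHom b c n q) (d : SpanHom a b m p) :
    ∃ f : SpanHom a c (s.snd ≫ m) (s.fst ≫ q), IsPair s f e d ∧
      pair hs hP hQ e.cls d.cls = f.cls :=
  ⟨_, (IsPair.exists hs hP e d).choose_spec, rfl⟩

/-- A morphism of spans restricted to the right legs, with `v` as the other leg of the target. -/
abbrev SpanHom.left {K K' : M} {a : K ⟶ X} {c : K ⟶ Z} {a' : K' ⟶ X} {c' : K' ⟶ Z}
    (g : SpanHom a c a' c') (v : K' ⟶ Y) : SpanHom (g.h ≫ v) c v c' := ⟨g.h, 𝟙 _, g.rho⟩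

/-- A morphism of spans restricted to the left legs, with `v` as the other leg of the target. -/
abbrev SpanHom.right {K K' : M} {a : K ⟶ X} {c : K ⟶ Z} {a' : K' ⟶ X} {c' : K' ⟶ Z}
    (g : SpanHom a c a' c') (v : K' ⟶ Y) : SpanHom a (g.h ≫ v) a' v := ⟨g.h, g.lam, Iso.refl _⟩

theorem IsPair.precomp {K' : M} {a' : K' ⟶ X} {c' : K' ⟶ Z} (g : SpanHom a' c' a c)
    {f : SpanHom a c (s.snd ≫ m) (s.fst ≫ q)} {e : SpanHom b c n q} {d : SpanHom a b m p}
    (h : IsPair s f e d) :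
    IsPair s (g.comp f) ((g.left b).comp e) ((g.right b).comp d) := by
  obtain ⟨σ, τ, h₁, h₂, h₃⟩ := h
  refine ⟨(α_ _ _ _).hom ≫ g.h ◁ σ, whiskerLeftIso g.h τ ≪≫ (α_ _ _ _).symm, ?_, ?_, ?_⟩
  · calc _ = (α_ _ _ _).hom ≫ g.h ◁ (τ.hom ▷ n ≫ (s.cmp f.h).hom ≫ σ ▷ p) ≫ (α_ _ _ _).inv := by
          simp only [IsoSquare.cmp_hom, Iso.trans_hom, whiskerLeftIso_hom, Iso.symm_hom]
          bicategory
      _ = _ := by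
          rw [h₁]
          simp
  · simp [h₂]
  · simp [h₃]

theorem IsPair.postcomp {S' T' : M} {m' : S' ⟶ X} {p' : S' ⟶ Y} {n' : T' ⟶ Y} {q' : T' ⟶ Z}
    {s' : IsoSquare n' p'} {g : SpanHom m p m' p'} {k : SpanHom n q n' q'}
    {f : SpanHom a c (s.snd ≫ m) (s.fst ≫ q)} {e : SpanHom b c n q} {d : SpanHom a b m p}
    {f' : SpanHom (s.snd ≫ m) (s.fst ≫ q) (s'.snd ≫ m') (s'.fst ≫ q')}
    (h : IsPair s f e d) (h' : IsPair s' f' ((SpanHom.π₂ q s).comp k) ((SpanHom.π₁ m s).comp g)) :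
    IsPair s' (f.comp f') (e.comp k) (d.comp g) := by
  obtain ⟨σ, τ, h₁, h₂, h₃⟩ := h
  obtain ⟨σ', τ', h₁', h₂', h₃'⟩ := h'
  refine ⟨(α_ _ _ _).hom ≫ f.h ◁ σ' ≫ (α_ _ _ _).inv ≫ σ ▷ g.h,
    whiskerRightIso τ k.h ≪≫ α_ _ _ _ ≪≫ whiskerLeftIso f.h τ' ≪≫ (α_ _ _ _).symm, ?_, ?_, ?_⟩
  · simp only [Iso.trans_hom, whiskerRightIso_hom, whiskerLeftIso_hom, Iso.symm_hom, Iso.refl_hom]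
      at h₁' ⊢
    calc _ = 𝟙 _ ⊗≫ (τ.hom ▷ k.h) ▷ n' ⊗≫
            f.h ◁ (τ'.hom ▷ n' ≫ (s'.cmp f'.h).hom ≫ σ' ▷ p') ⊗≫ (σ ▷ g.h) ▷ p' ⊗≫ 𝟙 _ := by
          simp only [IsoSquare.cmp_hom]
          bicategory
      _ = 𝟙 _ ⊗≫ (τ.hom ▷ (k.h ≫ n') ≫ (f.h ≫ s.fst) ◁ k.lam) ⊗≫ f.h ◁ s.iso.hom ⊗≫
            ((f.h ≫ s.snd) ◁ g.rho.hom ≫ σ ▷ (g.h ≫ p')) ⊗≫ 𝟙 _ := by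
          rw [h₁']
          bicategory
      _ = 𝟙 _ ⊗≫ e.h ◁ k.lam ⊗≫ (τ.hom ▷ n ≫ (s.cmp f.h).hom ≫ σ ▷ p) ⊗≫
            d.h ◁ g.rho.hom ⊗≫ 𝟙 _ := by
          rw [← whisker_exchange τ.hom k.lam, whisker_exchange σ g.rho.hom, IsoSquare.cmp_hom]
          bicategory
      _ = _ := by
          rw [h₁]
          bicategory
  · simp only [h₂, h₂']
    calc _ = 𝟙 _ ⊗≫ f.h ◁ σ' ▷ m' ⊗≫ ((f.h ≫ s.snd) ◁ g.lam ≫ σ ▷ m) ⊗≫ d.lam := by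
          bicategory
      _ = _ := by
          rw [whisker_exchange]
          bicategory
  · simp only [Iso.trans_hom, whiskerRightIso_hom, whiskerLeftIso_hom, Iso.symm_hom, Iso.refl_hom,
      h₃, h₃']
    calc _ = e.rho.hom ≫ 𝟙 _ ⊗≫ (τ.hom ▷ q ≫ (f.h ≫ s.fst) ◁ k.rho.hom) ⊗≫
            f.h ◁ τ'.hom ▷ q' ⊗≫ 𝟙 _ := by
          bicategory
      _ = _ := by
          rw [← whisker_exchange]
          bicategory

theorem isPair_id : IsPair s (SpanHom.id (s.snd ≫ m) (s.fst ≫ q)) (SpanHom.π₂ q s)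
    (SpanHom.π₁ m s) := by
  refine ⟨(λ_ _).hom, (λ_ _).symm, ?_, ?_, ?_⟩
  · simp [IsoSquare.cmp_hom]
  · simp
  · simp

theorem IsPair.change_middle {b' : K ⟶ Y} (β : b ⟶ b')
    {f : SpanHom a c (s.snd ≫ m) (s.fst ≫ q)} {e : SpanHom b c n q} {d : SpanHom a b m p}
    {d' : SpanHom a b' m p} (h : IsPair s f e d) (κ : d.h ⟶ d'.h)
    (h₁ : κ ▷ m ≫ d'.lam = d.lam) (h₂ : d.rho.hom ≫ κ ▷ p = β ≫ d'.rho.hom) :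
    IsPair s f ⟨e.h, e.lam ≫ β, e.rho⟩ d' := by
  obtain ⟨σ, τ, h₃, h₄, h₅⟩ := h
  refine ⟨σ ≫ κ, τ, ?_, ?_, h₅⟩
  · rw [comp_whiskerRight, Category.assoc, ← h₂, ← reassoc_of% h₃]
  · rw [h₄, ← h₁, comp_whiskerRight, Category.assoc]

theorem IsPair.leftUnitor {s : IsoSquare m (𝟙 X)} {b : K ⟶ X} {c : K ⟶ Y}
    {f : SpanHom a c (s.snd ≫ 𝟙 X) (s.fst ≫ p)} {e : SpanHom b c m p}
    {d : SpanHom a b (𝟙 X) (𝟙 X)} (h : IsPair s f e d) :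
    (f.comp (SpanHom.π₂ p s)).cls =
      SpanHom.cls ⟨e.h, e.lam ≫ d.rho.hom ≫ d.lam, e.rho⟩ := by
  obtain ⟨σ, τ, h₁, h₂, h₃⟩ := h
  refine SpanHom.cls_eq τ.inv ?_ ?_
  · rw [← reassoc_of% h₁]
    simp [h₂, IsoSquare.cmp_hom]
  · simp [h₃]

/-- The right unitor. -/
abbrev SpanHom.rightUnitorHom (m : S ⟶ X) {p : S ⟶ Y} (s : IsoSquare (𝟙 Y) p) :
    SpanHom (s.snd ≫ m) (s.fst ≫ 𝟙 Y) m p := ⟨s.snd, 𝟙 _, s.iso⟩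

theorem IsPair.rightUnitor {s : IsoSquare (𝟙 Y) p} {c : K ⟶ Y}
    {f : SpanHom a c (s.snd ≫ m) (s.fst ≫ 𝟙 Y)} {e : SpanHom b c (𝟙 Y) (𝟙 Y)}
    {d : SpanHom a b m p} (h : IsPair s f e d) (ι : c ≅ b) (hι : ι.hom = e.rho.hom ≫ e.lam) :
    (f.comp (SpanHom.rightUnitorHom m s)).cls = SpanHom.cls ⟨d.h, d.lam, ι ≪≫ d.rho⟩ := by
  obtain ⟨σ, τ, h₁, h₂, h₃⟩ := h
  refine SpanHom.cls_eq σ ?_ ?_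
  · simp [h₂]
  · simp only [Iso.trans_hom, hι, Category.assoc, ← h₁, h₃]
    simp [IsoSquare.cmp_hom]

/-- The auxiliary morphism from `(p, S, p)` to the identity span. -/
abbrev SpanHom.toId (p : S ⟶ Y) : SpanHom p p (𝟙 Y) (𝟙 Y) := ⟨p, (ρ_ p).hom, (ρ_ p).symm⟩

theorem isPair_leftUnitor (s : IsoSquare m (𝟙 X)) :
    IsPair s (SpanHom.id (s.snd ≫ 𝟙 X) (s.fst ≫ p))
      (((SpanHom.π₂ p s).left m).comp (SpanHom.id m p))
      (((SpanHom.π₂ p s).right m).comp (SpanHom.toId m)) := by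
  refine ⟨(λ_ _).hom ≫ (ρ_ _).inv ≫ s.iso.inv, ρ_ _ ≪≫ (λ_ _).symm, ?_, ?_, ?_⟩
  · simp only [IsoSquare.cmp_hom, Iso.trans_hom, Iso.symm_hom, Iso.refl_hom, whiskerLeftIso_hom]
    calc _ = 𝟙 _ ⊗≫ (s.iso.hom ≫ s.iso.inv) ⊗≫ 𝟙 _ := by bicategory
      _ = _ := by rw [Iso.hom_inv_id]; bicategory
  · simp only []
    calc _ = 𝟙 _ ⊗≫ (s.iso.inv ≫ s.iso.hom) ⊗≫ 𝟙 _ := by rw [Iso.inv_hom_id]; bicategory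
      _ = _ := by bicategory
  · simp only [Iso.trans_hom, Iso.symm_hom, Iso.refl_hom, whiskerLeftIso_hom]
    bicategory

theorem isPair_rightUnitor (s : IsoSquare (𝟙 Y) p) :
    IsPair s (SpanHom.id (s.snd ≫ m) (s.fst ≫ 𝟙 Y))
      (((SpanHom.rightUnitorHom m s).left p).comp (SpanHom.toId p))
      (((SpanHom.rightUnitorHom m s).right p).comp (SpanHom.id m p)) := by
  refine ⟨(λ_ _).hom ≫ (ρ_ _).inv, s.iso.symm ≪≫ ρ_ _ ≪≫ (λ_ _).symm, ?_, ?_, ?_⟩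
  · simp only [IsoSquare.cmp_hom, Iso.trans_hom, Iso.symm_hom, Iso.refl_hom, whiskerLeftIso_hom]
    calc _ = 𝟙 _ ⊗≫ (s.iso.inv ≫ s.iso.hom) ⊗≫ 𝟙 _ := by bicategory
      _ = _ := by rw [Iso.inv_hom_id]; bicategory
  · simp only []
    bicategory
  · simp only [Iso.trans_hom, Iso.symm_hom, Iso.refl_hom, whiskerLeftIso_hom]
    calc _ = 𝟙 _ ⊗≫ (s.iso.hom ≫ s.iso.inv) ⊗≫ 𝟙 _ := by rw [Iso.hom_inv_id]; bicategory
      _ = _ := by bicategory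


end Pairing

section Assoc

variable {M : Type u} [Bicategory.{w, v} M] {X Y Z W S T R : M} {m : S ⟶ X} {p : S ⟶ Y}
  {n : T ⟶ Y} {q : T ⟶ Z} {r : R ⟶ Z} {t : R ⟶ W}

theorem exists_hom_of_square {s : IsoSquare n p} (hs : s.IsBipullback)
    (hP : IsGroupoidFibration p) {K : M} {f x : K ⟶ s.pt} {e : K ⟶ T} {d : K ⟶ S}
    (σ : f ≫ s.snd ⟶ d) (τ : e ≅ f ≫ s.fst) {ψ : e ≫ n ⟶ d ≫ p}
    (h : τ.hom ▷ n ≫ (s.cmp f).hom ≫ σ ▷ p = ψ)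
    (α : x ≫ s.fst ⟶ e) (β : x ≫ s.snd ⟶ d) (w : α ▷ n ≫ ψ = (s.cmp x).hom ≫ β ▷ p) :
    ∃ η : x ⟶ f, η ▷ s.fst = α ≫ τ.hom ∧ η ▷ s.snd ≫ σ = β := by
  obtain ⟨l, ⟨hl, (hl' : l ▷ p = (s.cmp x).inv ≫ (α ≫ τ.hom) ▷ n ≫ (s.cmp f).hom)⟩, -⟩ :=
    (hP K).cartesian σ β ((s.cmp x).inv ≫ (α ≫ τ.hom) ▷ n ≫ (s.cmp f).hom) (by
      change ((s.cmp x).inv ≫ (α ≫ τ.hom) ▷ n ≫ (s.cmp f).hom) ≫ σ ▷ p = β ▷ p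
      rw [comp_whiskerRight, Category.assoc, Category.assoc, Category.assoc, h, w]
      simp)
  obtain ⟨η, hη₁, hη₂⟩ := hs.exists_hom (x := x) (y := f) (α ≫ τ.hom) l (by
    rw [hl', Iso.hom_inv_id_assoc])
  exact ⟨η, hη₁, by rw [hη₂, hl]⟩

variable {K : M} {a : K ⟶ X} {b : K ⟶ Y} {c : K ⟶ Z} {k : K ⟶ W}

theorem IsPair.assoc {s₁ : IsoSquare n p} {s₂ : IsoSquare r q} {s₁₂ : IsoSquare r (s₁.fst ≫ q)}
    {s₂₃ : IsoSquare (s₂.snd ≫ n) p}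
    {x : SpanHom (s₁₂.snd ≫ s₁.snd ≫ p) (s₁₂.fst ≫ t) (s₂.snd ≫ n) (s₂.fst ≫ t)}
    (hx : IsPair s₂ x (SpanHom.π₂ t s₁₂)
      (((SpanHom.π₁ (s₁.snd ≫ m) s₁₂).left (s₁.snd ≫ p)).comp (SpanHom.π₂ q s₁)))
    {A : SpanHom (s₁₂.snd ≫ s₁.snd ≫ m) (s₁₂.fst ≫ t) (s₂₃.snd ≫ m) (s₂₃.fst ≫ s₂.fst ≫ t)}
    (hA : IsPair s₂₃ A x
      (((SpanHom.π₁ (s₁.snd ≫ m) s₁₂).right (s₁.snd ≫ p)).comp (SpanHom.π₁ m s₁)))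
    {F : SpanHom a k (s₁₂.snd ≫ s₁.snd ≫ m) (s₁₂.fst ≫ t)} {f : SpanHom a c (s₁.snd ≫ m) (s₁.fst ≫ q)}
    {e : SpanHom c k r t} {e' : SpanHom b c n q} {d : SpanHom a b m p}
    (hF : IsPair s₁₂ F e f) (hf : IsPair s₁ f e' d) :
    ∃ y : SpanHom b k (s₂.snd ≫ n) (s₂.fst ≫ t), IsPair s₂ y e e' ∧ IsPair s₂₃ (F.comp A) y d := by
  obtain ⟨σx, τx, hx₁, hx₂, hx₃⟩ := hx
  obtain ⟨σA, τA, hA₁, hA₂, hA₃⟩ := hA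
  obtain ⟨σF, τF, hF₁, hF₂, hF₃⟩ := hF
  obtain ⟨σf, τf, hf₁, hf₂, hf₃⟩ := hf
  let σy : (F.h ≫ x.h) ≫ s₂.snd ⟶ e'.h := (α_ _ _ _).hom ≫ F.h ◁ σx ≫ (α_ _ _ _).inv ≫
      σF ▷ s₁.fst ≫ τf.inv
  let τy : e.h ≅ (F.h ≫ x.h) ≫ s₂.fst := τF ≪≫ whiskerLeftIso F.h τx ≪≫ (α_ _ _ _).symm
  refine ⟨⟨F.h ≫ x.h, (α_ _ _ _).inv ≫ σy ▷ n ≫ e'.lam,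
    e.rho ≪≫ whiskerRightIso τy t ≪≫ α_ _ _ _⟩, ⟨σy, τy, ?_, rfl, rfl⟩,
    ⟨(α_ _ _ _).hom ≫ F.h ◁ σA ≫ (α_ _ _ _).inv ≫ σF ▷ s₁.snd ≫ σf,
      whiskerLeftIso F.h τA ≪≫ (α_ _ _ _).symm, ?_, ?_, ?_⟩⟩
  · have hf₃' : e'.rho.hom = f.rho.hom ≫ (α_ f.h s₁.fst q).inv ≫ τf.inv ▷ q := by simp [hf₃]
    rw [hf₃', ← reassoc_of% hF₁]
    simp only [Iso.trans_hom, whiskerLeftIso_hom, Iso.symm_hom, Iso.refl_hom,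
      IsoSquare.cmp_hom, σy, τy] at hx₁ ⊢
    calc _ = 𝟙 _ ⊗≫ τF.hom ▷ r ⊗≫ F.h ◁ (τx.hom ▷ r ≫ (s₂.cmp x.h).hom ≫ σx ▷ q) ⊗≫
              σF ▷ s₁.fst ▷ q ⊗≫ τf.inv ▷ q ⊗≫ 𝟙 _ := by
          simp only [IsoSquare.cmp_hom]
          bicategory
      _ = _ := by
        rw [IsoSquare.cmp_hom, hx₁]
        bicategory
  · simp only [Iso.trans_hom, whiskerLeftIso_hom, Iso.symm_hom, Iso.refl_hom,
      IsoSquare.cmp_hom, hx₂, σy] at hA₁ ⊢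
    calc _ = 𝟙 _ ⊗≫ F.h ◁ (τA.hom ▷ (s₂.snd ≫ n) ≫ (s₂₃.cmp A.h).hom ≫ σA ▷ p) ⊗≫
              σF ▷ (s₁.snd ≫ p) ⊗≫ σf ▷ p := by
          simp only [IsoSquare.cmp_hom]
          bicategory
      _ = 𝟙 _ ⊗≫ F.h ◁ σx ▷ n ⊗≫ ((F.h ≫ s₁₂.snd) ◁ s₁.iso.hom ≫ σF ▷ (s₁.snd ≫ p)) ⊗≫ σf ▷ p := by
        rw [IsoSquare.cmp_hom, hA₁]
        bicategory
      _ = 𝟙 _ ⊗≫ F.h ◁ σx ▷ n ⊗≫ σF ▷ s₁.fst ▷ n ⊗≫ (τf.inv ≫ τf.hom) ▷ n ⊗≫ f.h ◁ s₁.iso.hom ⊗≫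
            σf ▷ p := by
        rw [whisker_exchange, Iso.inv_hom_id]
        bicategory
      _ = 𝟙 _ ⊗≫ F.h ◁ σx ▷ n ⊗≫ σF ▷ s₁.fst ▷ n ⊗≫ τf.inv ▷ n ⊗≫
            (τf.hom ▷ n ≫ (s₁.cmp f.h).hom ≫ σf ▷ p) := by
        rw [IsoSquare.cmp_hom]
        bicategory
      _ = _ := by
        rw [hf₁]
        bicategory
  · simp only [hA₂, hF₂, hf₂]
    bicategory
  · simp only [Iso.trans_hom, whiskerLeftIso_hom, whiskerRightIso_hom, Iso.symm_hom, Iso.refl_hom,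
      hA₃, hx₃, hF₃, τy]
    bicategory

theorem IsPair.assoc_inv {s₁ : IsoSquare n p} (hs₁ : s₁.IsBipullback) (hP : IsGroupoidFibration p)
    {s₂ : IsoSquare r q} {s₁₂ : IsoSquare r (s₁.fst ≫ q)} {s₂₃ : IsoSquare (s₂.snd ≫ n) p}
    {x : SpanHom (s₂₃.snd ≫ m) (s₂₃.fst ≫ s₂.snd ≫ q) (s₁.snd ≫ m) (s₁.fst ≫ q)}
    (hx : IsPair s₁ x
      (((SpanHom.π₂ (s₂.fst ≫ t) s₂₃).right (s₂.snd ≫ q)).comp (SpanHom.π₁ n s₂))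
      (SpanHom.π₁ m s₂₃))
    {A : SpanHom (s₂₃.snd ≫ m) (s₂₃.fst ≫ s₂.fst ≫ t) (s₁₂.snd ≫ s₁.snd ≫ m) (s₁₂.fst ≫ t)}
    (hA : IsPair s₁₂ A
      (((SpanHom.π₂ (s₂.fst ≫ t) s₂₃).left (s₂.snd ≫ q)).comp (SpanHom.π₂ t s₂)) x)
    {F : SpanHom a k (s₂₃.snd ≫ m) (s₂₃.fst ≫ s₂.fst ≫ t)}
    {y : SpanHom b k (s₂.snd ≫ n) (s₂.fst ≫ t)} {f : SpanHom a c (s₁.snd ≫ m) (s₁.fst ≫ q)}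
    {e : SpanHom c k r t} {e' : SpanHom b c n q} {d : SpanHom a b m p}
    (hF : IsPair s₂₃ F y d) (hy : IsPair s₂ y e e') (hf : IsPair s₁ f e' d) :
    IsPair s₁₂ (F.comp A) e f := by
  obtain ⟨σx, τx, hx₁, hx₂, hx₃⟩ := hx
  obtain ⟨σA, τA, hA₁, hA₂, hA₃⟩ := hA
  obtain ⟨σF, τF, hF₁, hF₂, hF₃⟩ := hF
  obtain ⟨σf, τf, hf₁, hf₂, hf₃⟩ := hf
  obtain ⟨σy, τy, hy₁, hy₂, hy₃⟩ := hy
  simp only [Iso.trans_hom, whiskerLeftIso_hom, Iso.symm_hom, Iso.refl_hom] at hx₁ hA₁ hx₃ hA₃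
  obtain ⟨η, hη₁, hη₂⟩ := exists_hom_of_square hs₁ hP σf τf hf₁ (x := F.h ≫ x.h)
    ((α_ _ _ _).hom ≫ F.h ◁ τx.inv ≫ (α_ _ _ _).inv ≫ τF.inv ▷ s₂.snd ≫ σy)
    ((α_ _ _ _).hom ≫ F.h ◁ σx ≫ σF) (by
      symm
      calc _ = 𝟙 _ ⊗≫ F.h ◁ (τx.inv ≫ τx.hom) ▷ n ⊗≫ F.h ◁ x.h ◁ s₁.iso.hom ⊗≫
            F.h ◁ σx ▷ p ⊗≫ σF ▷ p := by
            rw [Iso.inv_hom_id, IsoSquare.cmp_hom]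
            bicategory
        _ = 𝟙 _ ⊗≫ F.h ◁ τx.inv ▷ n ⊗≫ F.h ◁ (τx.hom ▷ n ≫ (s₁.cmp x.h).hom ≫ σx ▷ p) ⊗≫
            σF ▷ p := by
            rw [IsoSquare.cmp_hom]
            bicategory
        _ = 𝟙 _ ⊗≫ F.h ◁ τx.inv ▷ n ⊗≫ (τF.inv ≫ τF.hom) ▷ (s₂.snd ≫ n) ⊗≫ F.h ◁ s₂₃.iso.hom ⊗≫
            σF ▷ p := by
            rw [hx₁, Iso.inv_hom_id]
            bicategory
        _ = 𝟙 _ ⊗≫ F.h ◁ τx.inv ▷ n ⊗≫ τF.inv ▷ (s₂.snd ≫ n) ⊗≫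
            (τF.hom ▷ (s₂.snd ≫ n) ≫ (s₂₃.cmp F.h).hom ≫ σF ▷ p) := by
            rw [IsoSquare.cmp_hom]
            bicategory
        _ = _ := by
            rw [hF₁, hy₂]
            bicategory)
  refine ⟨(α_ _ _ _).hom ≫ F.h ◁ σA ≫ η, τy ≪≫ whiskerRightIso τF s₂.fst ≪≫ α_ _ _ _ ≪≫
    whiskerLeftIso F.h τA ≪≫ (α_ _ _ _).symm, ?_, ?_, ?_⟩
  · simp only [Iso.trans_hom, whiskerLeftIso_hom, whiskerRightIso_hom, Iso.symm_hom]
    calc _ = 𝟙 _ ⊗≫ τy.hom ▷ r ⊗≫ τF.hom ▷ s₂.fst ▷ r ⊗≫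
            F.h ◁ (τA.hom ▷ r ≫ (s₁₂.cmp A.h).hom ≫ σA ▷ (s₁.fst ≫ q)) ⊗≫ (η ▷ s₁.fst) ▷ q ⊗≫
              𝟙 _ := by
          simp only [IsoSquare.cmp_hom]
          bicategory
      _ = 𝟙 _ ⊗≫ τy.hom ▷ r ⊗≫ (τF.hom ▷ (s₂.fst ≫ r) ≫ (F.h ≫ s₂₃.fst) ◁ s₂.iso.hom) ⊗≫
            F.h ◁ (τx.hom ≫ τx.inv) ▷ q ⊗≫ τF.inv ▷ s₂.snd ▷ q ⊗≫ σy ▷ q ⊗≫ τf.hom ▷ q ⊗≫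
              𝟙 _ := by
          rw [hA₁, hη₁, hx₃]
          bicategory
      _ = 𝟙 _ ⊗≫ τy.hom ▷ r ⊗≫ y.h ◁ s₂.iso.hom ⊗≫ (τF.hom ≫ τF.inv) ▷ s₂.snd ▷ q ⊗≫
            σy ▷ q ⊗≫ τf.hom ▷ q ⊗≫ 𝟙 _ := by
          rw [← whisker_exchange, Iso.hom_inv_id]
          bicategory
      _ = 𝟙 _ ⊗≫ (τy.hom ▷ r ≫ (s₂.cmp y.h).hom ≫ σy ▷ q) ⊗≫ τf.hom ▷ q ⊗≫ 𝟙 _ := by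
          rw [Iso.hom_inv_id, IsoSquare.cmp_hom]
          bicategory
      _ = _ := by
          rw [hy₁, hf₃]
          bicategory
  · simp only [hA₂, hF₂, hf₂, hx₂]
    symm
    calc _ = 𝟙 _ ⊗≫ F.h ◁ σA ▷ (s₁.snd ≫ m) ⊗≫ (η ▷ s₁.snd ≫ σf) ▷ m ⊗≫ d.lam := by
          bicategory
      _ = _ := by
          rw [hη₂]
          bicategory
  · simp only [Iso.trans_hom, whiskerLeftIso_hom, whiskerRightIso_hom, Iso.symm_hom, hA₃, hF₃, hy₃]
    bicategory

end Assoc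

section Polynomials

variable {M : Type u} [Bicategory.{w, v} M]

/-- A *polynomial* `(m, S, p)` from `X` to `Y` in a calibrated bicategory: a span
with legs `m : S ⟶ X` and `p : S ⟶ Y`, where `m` is a right lifter and `p` neat. -/
structure Polynomial (c : Calibration M) (X Y : M) where
  apex : M
  l : apex ⟶ X
  r : apex ⟶ Y
  lifter : IsRightLifter l
  neat : c.neat r

variable {c : Calibration M}

/-- The category of polynomials from `X` to `Y`: morphisms are path components of morphisms of
spans. -/
instance (X Y : M) : Category (Polynomial c X Y) where
  Hom P Q := SpanHom.Cls P.l P.r Q.l Q.r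
  id P := (SpanHom.id P.l P.r).cls
  comp f g := SpanHom.Cls.comp f g
  id_comp := SpanHom.Cls.id_comp
  comp_id := SpanHom.Cls.comp_id
  assoc := SpanHom.Cls.assoc

namespace Polynomial

variable {W X Y Z V : M}

variable (c X) in
/-- The identity polynomial. -/
abbrev id : Polynomial c X X :=
  ⟨X, 𝟙 X, 𝟙 X, isRightLifter_id X, c.neat_of_equivalence (Bicategory.Equivalence.id X)⟩

/-- A chosen bipullback for the composition of two polynomials. -/
noncomputable def square (P : Polynomial c X Y) (Q : Polynomial c Y Z) : IsoSquare Q.l P.r :=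
  (c.exists_isBipullback P.neat Q.lifter).choose

theorem isBipullback_square (P : Polynomial c X Y) (Q : Polynomial c Y Z) :
    (P.square Q).IsBipullback :=
  (c.exists_isBipullback P.neat Q.lifter).choose_spec.1

theorem neat_square (P : Polynomial c X Y) (Q : Polynomial c Y Z) : c.neat (P.square Q).fst :=
  (c.exists_isBipullback P.neat Q.lifter).choose_spec.2

/-- The composite of two polynomials, by bipullback. -/
noncomputable abbrev comp (P : Polynomial c X Y) (Q : Polynomial c Y Z) : Polynomial c X Z where
  apex := (P.square Q).pt
  l := (P.square Q).snd ≫ P.l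
  r := (P.square Q).fst ≫ Q.r
  lifter := ((P.isBipullback_square Q).isRightLifter_snd Q.lifter
    (c.isGroupoidFibration P.neat)).comp P.lifter
  neat := (c.neat_comp_iff _ Q.neat).2 (P.neat_square Q)

/-- The pairing of classes of morphisms for the chosen bipullback. -/
noncomputable def pr (P : Polynomial c X Y) (Q : Polynomial c Y Z) {K : M} {a : K ⟶ X} {b : K ⟶ Y}
    {k : K ⟶ Z} (e : SpanHom.Cls b k Q.l Q.r) (d : SpanHom.Cls a b P.l P.r) :
    SpanHom.Cls a k (P.comp Q).l (P.comp Q).r :=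
  pair (P.isBipullback_square Q) (c.isGroupoidFibration P.neat) (c.isGroupoidFibration Q.neat) e d

section

variable {K : M} {a : K ⟶ X} {b : K ⟶ Y} {k : K ⟶ Z}

theorem _root_.CalibratedBicategory.IsPair.pr_eq {P : Polynomial c X Y} {Q : Polynomial c Y Z}
    {f : SpanHom a k (P.comp Q).l (P.comp Q).r}
    {e : SpanHom b k Q.l Q.r} {d : SpanHom a b P.l P.r} (h : IsPair (P.square Q) f e d) :
    P.pr Q e.cls d.cls = f.cls :=
  IsPair.pair_eq h

theorem exists_pr_eq (P : Polynomial c X Y) (Q : Polynomial c Y Z)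
    (e : SpanHom b k Q.l Q.r) (d : SpanHom a b P.l P.r) :
    ∃ f : SpanHom a k (P.comp Q).l (P.comp Q).r, IsPair (P.square Q) f e d ∧
      P.pr Q e.cls d.cls = f.cls :=
  exists_pair_eq _ _ _ _ _

theorem eq_pr (P : Polynomial c X Y) (Q : Polynomial c Y Z)
    (f : SpanHom a k (P.comp Q).l (P.comp Q).r) :
    f.cls = P.pr Q ((f.left ((P.square Q).snd ≫ P.r)).comp (SpanHom.π₂ Q.r (P.square Q))).cls
      ((f.right ((P.square Q).snd ≫ P.r)).comp (SpanHom.π₁ P.l (P.square Q))).cls := by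
  rw [(isPair_id.precomp f).pr_eq]
  exact (SpanHom.Cls.comp_id f.cls).symm

theorem exists_eq_pr (P : Polynomial c X Y) (Q : Polynomial c Y Z)
    (f : SpanHom.Cls a k (P.comp Q).l (P.comp Q).r) :
    ∃ (b : K ⟶ Y) (e : SpanHom.Cls b k Q.l Q.r) (d : SpanHom.Cls a b P.l P.r), f = P.pr Q e d := by
  obtain ⟨f⟩ := f
  exact ⟨_, _, _, eq_pr P Q f⟩

end

/-- Horizontal composition of morphisms of polynomials. -/
noncomputable def hcomp {P P' : Polynomial c X Y} {Q Q' : Polynomial c Y Z} (f : P ⟶ P')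
    (g : Q ⟶ Q') : P.comp Q ⟶ P'.comp Q' :=
  P'.pr Q' ((SpanHom.π₂ Q.r (P.square Q)).cls.comp g) ((SpanHom.π₁ P.l (P.square Q)).cls.comp f)

section

variable {K : M} {a : K ⟶ X} {b : K ⟶ Y} {k : K ⟶ Z}

theorem pr_comp_hcomp {P P' : Polynomial c X Y} {Q Q' : Polynomial c Y Z} (f : P ⟶ P')
    (g : Q ⟶ Q') (e : SpanHom.Cls b k Q.l Q.r) (d : SpanHom.Cls a b P.l P.r) :
    (P.pr Q e d).comp (hcomp f g) = P'.pr Q' (e.comp g) (d.comp f) := by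
  obtain ⟨f⟩ := f
  obtain ⟨g⟩ := g
  obtain ⟨e⟩ := e
  obtain ⟨d⟩ := d
  obtain ⟨x, hx, hx'⟩ := exists_pr_eq P Q e d
  obtain ⟨y, hy, hy'⟩ := exists_pr_eq P' Q' ((SpanHom.π₂ Q.r (P.square Q)).comp g)
    ((SpanHom.π₁ P.l (P.square Q)).comp f)
  exact (congrArg₂ SpanHom.Cls.comp hx' hy').trans (hx.postcomp hy).pr_eq.symm

theorem pr_id (P : Polynomial c X Y) (Q : Polynomial c Y Z) :
    P.pr Q (SpanHom.π₂ Q.r (P.square Q)).cls (SpanHom.π₁ P.l (P.square Q)).cls = 𝟙 (P.comp Q) :=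
  isPair_id.pr_eq

end

theorem hcomp_id (P : Polynomial c X Y) (Q : Polynomial c Y Z) :
    hcomp (𝟙 P) (𝟙 Q) = 𝟙 (P.comp Q) := by
  rw [← pr_id]
  exact congrArg₂ (P.pr Q) (SpanHom.Cls.comp_id _) (SpanHom.Cls.comp_id _)

theorem hcomp_comp {P P' P'' : Polynomial c X Y} {Q Q' Q'' : Polynomial c Y Z} (f : P ⟶ P')
    (f' : P' ⟶ P'') (g : Q ⟶ Q') (g' : Q' ⟶ Q'') :
    hcomp (f ≫ f') (g ≫ g') = hcomp f g ≫ hcomp f' g' :=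
  (congrArg₂ (P''.pr Q'') (SpanHom.Cls.assoc _ _ _).symm (SpanHom.Cls.assoc _ _ _).symm).trans
    (pr_comp_hcomp f' g' _ _).symm

section

/-- The associator. -/
noncomputable def assocHom (P : Polynomial c X Y) (Q : Polynomial c Y Z) (R : Polynomial c Z W) :
    (P.comp Q).comp R ⟶ P.comp (Q.comp R) :=
  P.pr (Q.comp R)
    (Q.pr R (SpanHom.π₂ R.r ((P.comp Q).square R)).cls
      (((SpanHom.π₁ (P.comp Q).l ((P.comp Q).square R)).left ((P.square Q).snd ≫ P.r)).comp
        (SpanHom.π₂ Q.r (P.square Q))).cls)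
    (((SpanHom.π₁ (P.comp Q).l ((P.comp Q).square R)).right ((P.square Q).snd ≫ P.r)).comp
        (SpanHom.π₁ P.l (P.square Q))).cls

/-- The inverse of the associator. -/
noncomputable def assocInv (P : Polynomial c X Y) (Q : Polynomial c Y Z) (R : Polynomial c Z W) :
    P.comp (Q.comp R) ⟶ (P.comp Q).comp R :=
  (P.comp Q).pr R
    (((SpanHom.π₂ (Q.comp R).r (P.square (Q.comp R))).left ((Q.square R).snd ≫ Q.r)).comp
        (SpanHom.π₂ R.r (Q.square R))).cls
    (P.pr Q
      (((SpanHom.π₂ (Q.comp R).r (P.square (Q.comp R))).right ((Q.square R).snd ≫ Q.r)).comp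
        (SpanHom.π₁ Q.l (Q.square R))).cls
      (SpanHom.π₁ P.l (P.square (Q.comp R))).cls)

variable {K : M} {a : K ⟶ X} {b : K ⟶ Y} {k : K ⟶ Z} {j : K ⟶ W}

theorem pr_comp_assocHom (P : Polynomial c X Y) (Q : Polynomial c Y Z) (R : Polynomial c Z W)
    (e : SpanHom.Cls k j R.l R.r) (e' : SpanHom.Cls b k Q.l Q.r) (d : SpanHom.Cls a b P.l P.r) :
    ((P.comp Q).pr R e (P.pr Q e' d)).comp (assocHom P Q R) =
      P.pr (Q.comp R) (Q.pr R e e') d := by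
  obtain ⟨e⟩ := e
  obtain ⟨e'⟩ := e'
  obtain ⟨d⟩ := d
  obtain ⟨f, hf, hf'⟩ := exists_pr_eq P Q e' d
  obtain ⟨F, hF, hF'⟩ := exists_pr_eq (P.comp Q) R e f
  obtain ⟨x, hx, hx'⟩ := exists_pr_eq Q R (SpanHom.π₂ R.r ((P.comp Q).square R))
      (((SpanHom.π₁ (P.comp Q).l ((P.comp Q).square R)).left ((P.square Q).snd ≫ P.r)).comp
        (SpanHom.π₂ Q.r (P.square Q)))
  obtain ⟨A, hA, hA'⟩ := exists_pr_eq P (Q.comp R) x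
    (((SpanHom.π₁ (P.comp Q).l ((P.comp Q).square R)).right ((P.square Q).snd ≫ P.r)).comp
        (SpanHom.π₁ P.l (P.square Q)))
  obtain ⟨y, hy, hy'⟩ := IsPair.assoc hx hA hF hf
  change ((P.comp Q).pr R e.cls (P.pr Q e'.cls d.cls)).comp (assocHom P Q R) =
      P.pr (Q.comp R) (Q.pr R e.cls e'.cls) d.cls
  rw [hf', hF', assocHom, hx', hA', hy.pr_eq, hy'.pr_eq]
  rfl

theorem pr_comp_assocInv (P : Polynomial c X Y) (Q : Polynomial c Y Z) (R : Polynomial c Z W)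
    (e : SpanHom.Cls k j R.l R.r) (e' : SpanHom.Cls b k Q.l Q.r) (d : SpanHom.Cls a b P.l P.r) :
    (P.pr (Q.comp R) (Q.pr R e e') d).comp (assocInv P Q R) =
      (P.comp Q).pr R e (P.pr Q e' d) := by
  obtain ⟨e⟩ := e
  obtain ⟨e'⟩ := e'
  obtain ⟨d⟩ := d
  obtain ⟨f, hf, hf'⟩ := exists_pr_eq P Q e' d
  obtain ⟨y, hy, hy'⟩ := exists_pr_eq Q R e e'
  obtain ⟨F, hF, hF'⟩ := exists_pr_eq P (Q.comp R) y d
  obtain ⟨x, hx, hx'⟩ := exists_pr_eq P Q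
      (((SpanHom.π₂ (Q.comp R).r (P.square (Q.comp R))).right ((Q.square R).snd ≫ Q.r)).comp
        (SpanHom.π₁ Q.l (Q.square R)))
      (SpanHom.π₁ P.l (P.square (Q.comp R)))
  obtain ⟨A, hA, hA'⟩ := exists_pr_eq (P.comp Q) R
    (((SpanHom.π₂ (Q.comp R).r (P.square (Q.comp R))).left ((Q.square R).snd ≫ Q.r)).comp
        (SpanHom.π₂ R.r (Q.square R))) x
  change (P.pr (Q.comp R) (Q.pr R e.cls e'.cls) d.cls).comp (assocInv P Q R) =
      (P.comp Q).pr R e.cls (P.pr Q e'.cls d.cls)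
  rw [hf', hy', hF', assocInv, hx', hA']
  exact (IsPair.assoc_inv (P.isBipullback_square Q) (c.isGroupoidFibration P.neat) hx hA hF hy
    hf).pr_eq.symm

theorem exists_eq_pr_pr (P : Polynomial c X Y) (Q : Polynomial c Y Z) (R : Polynomial c Z W)
    (f : SpanHom.Cls a j ((P.comp Q).comp R).l ((P.comp Q).comp R).r) :
    ∃ (k : K ⟶ Z) (b : K ⟶ Y) (e : SpanHom.Cls k j R.l R.r) (e' : SpanHom.Cls b k Q.l Q.r)
      (d : SpanHom.Cls a b P.l P.r), f = (P.comp Q).pr R e (P.pr Q e' d) := by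
  obtain ⟨_, e, f, rfl⟩ := exists_eq_pr (P.comp Q) R f
  obtain ⟨_, e', d, rfl⟩ := exists_eq_pr P Q f
  exact ⟨_, _, _, _, _, rfl⟩

theorem exists_eq_pr_pr' (P : Polynomial c X Y) (Q : Polynomial c Y Z) (R : Polynomial c Z W)
    (f : SpanHom.Cls a j (P.comp (Q.comp R)).l (P.comp (Q.comp R)).r) :
    ∃ (k : K ⟶ Z) (b : K ⟶ Y) (e : SpanHom.Cls k j R.l R.r) (e' : SpanHom.Cls b k Q.l Q.r)
      (d : SpanHom.Cls a b P.l P.r), f = P.pr (Q.comp R) (Q.pr R e e') d := by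
  obtain ⟨_, f, d, rfl⟩ := exists_eq_pr P (Q.comp R) f
  obtain ⟨_, e, e', rfl⟩ := exists_eq_pr Q R f
  exact ⟨_, _, _, _, _, rfl⟩

end

theorem assoc_hom_inv (P : Polynomial c X Y) (Q : Polynomial c Y Z) (R : Polynomial c Z W) :
    assocHom P Q R ≫ assocInv P Q R = 𝟙 _ := by
  obtain ⟨_, _, e, e', d, h⟩ := exists_eq_pr_pr P Q R (𝟙 ((P.comp Q).comp R))
  rw [← Category.id_comp (assocHom P Q R), Category.assoc]
  change SpanHom.Cls.comp (𝟙 ((P.comp Q).comp R)) (SpanHom.Cls.comp _ _) = 𝟙 ((P.comp Q).comp R)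
  rw [h, ← SpanHom.Cls.assoc, pr_comp_assocHom, pr_comp_assocInv]

theorem assoc_inv_hom (P : Polynomial c X Y) (Q : Polynomial c Y Z) (R : Polynomial c Z W) :
    assocInv P Q R ≫ assocHom P Q R = 𝟙 _ := by
  obtain ⟨_, _, e, e', d, h⟩ := exists_eq_pr_pr' P Q R (𝟙 (P.comp (Q.comp R)))
  rw [← Category.id_comp (assocInv P Q R), Category.assoc]
  change SpanHom.Cls.comp (𝟙 (P.comp (Q.comp R))) (SpanHom.Cls.comp _ _) = 𝟙 (P.comp (Q.comp R))
  rw [h, ← SpanHom.Cls.assoc, pr_comp_assocInv, pr_comp_assocHom]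

theorem hcomp_assocHom {P P' : Polynomial c X Y} {Q Q' : Polynomial c Y Z} {R R' : Polynomial c Z W}
    (f : P ⟶ P') (g : Q ⟶ Q') (h : R ⟶ R') :
    hcomp (hcomp f g) h ≫ assocHom P' Q' R' = assocHom P Q R ≫ hcomp f (hcomp g h) := by
  obtain ⟨_, _, e, e', d, hF⟩ := exists_eq_pr_pr P Q R (𝟙 ((P.comp Q).comp R))
  rw [← Category.id_comp (hcomp (hcomp f g) h), ← Category.id_comp (assocHom P Q R)]
  change SpanHom.Cls.comp (SpanHom.Cls.comp (𝟙 ((P.comp Q).comp R)) _) _ =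
    SpanHom.Cls.comp (SpanHom.Cls.comp (𝟙 ((P.comp Q).comp R)) _) _
  rw [hF, pr_comp_hcomp, pr_comp_hcomp, pr_comp_assocHom, pr_comp_assocHom, pr_comp_hcomp,
    pr_comp_hcomp]

theorem pentagon (P : Polynomial c V X) (Q : Polynomial c X Y) (R : Polynomial c Y Z)
    (U : Polynomial c Z W) :
    hcomp (assocHom P Q R) (𝟙 U) ≫ assocHom P (Q.comp R) U ≫ hcomp (𝟙 P) (assocHom Q R U) =
      assocHom (P.comp Q) R U ≫ assocHom P Q (R.comp U) := by
  obtain ⟨_, _, e, e', d, hF⟩ := exists_eq_pr_pr (P.comp Q) R U (𝟙 (((P.comp Q).comp R).comp U))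
  obtain ⟨_, d, d', rfl⟩ := exists_eq_pr P Q d
  rw [← Category.id_comp (assocHom (P.comp Q) R U), ← Category.id_comp (hcomp (assocHom P Q R) _),
    ← Category.assoc]
  change SpanHom.Cls.comp (SpanHom.Cls.comp
      (SpanHom.Cls.comp (𝟙 (((P.comp Q).comp R).comp U)) _) _) _ =
    SpanHom.Cls.comp (SpanHom.Cls.comp (𝟙 (((P.comp Q).comp R).comp U)) _) _
  rw [hF, pr_comp_hcomp, pr_comp_assocHom, pr_comp_assocHom, pr_comp_assocHom, pr_comp_assocHom,
    pr_comp_hcomp, pr_comp_assocHom]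
  rw [show SpanHom.Cls.comp e (𝟙 U) = e from SpanHom.Cls.comp_id e,
    show SpanHom.Cls.comp d' (𝟙 P) = d' from SpanHom.Cls.comp_id d']

section

variable {K : M} {a : K ⟶ X} {b : K ⟶ Y} {k : K ⟶ Z}

/-- The left unitor. -/
noncomputable def leftUnitorHom (P : Polynomial c X Y) : (id c X).comp P ⟶ P :=
  (SpanHom.π₂ P.r ((id c X).square P)).cls

/-- The inverse of the left unitor. -/
noncomputable def leftUnitorInv (P : Polynomial c X Y) : P ⟶ (id c X).comp P :=
  (id c X).pr P (SpanHom.id P.l P.r).cls (SpanHom.toId P.l).cls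

/-- The right unitor. -/
noncomputable def rightUnitorHom (P : Polynomial c X Y) : P.comp (id c Y) ⟶ P :=
  (SpanHom.rightUnitorHom P.l (P.square (id c Y))).cls

/-- The inverse of the right unitor. -/
noncomputable def rightUnitorInv (P : Polynomial c X Y) : P ⟶ P.comp (id c Y) :=
  P.pr (id c Y) (SpanHom.toId P.r).cls (SpanHom.id P.l P.r).cls

theorem pr_comp_leftUnitorHom {a b : K ⟶ X} {k : K ⟶ Y} (P : Polynomial c X Y)
    (e : SpanHom b k P.l P.r) (d : SpanHom a b (id c X).l (id c X).r) :
    ((id c X).pr P e.cls d.cls).comp (leftUnitorHom P) =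
      SpanHom.cls ⟨e.h, e.lam ≫ d.rho.hom ≫ d.lam, e.rho⟩ := by
  obtain ⟨f, hf, hf'⟩ := exists_pr_eq (id c X) P e d
  rw [hf']
  exact hf.leftUnitor

theorem pr_comp_rightUnitorHom {b k : K ⟶ Y} (P : Polynomial c X Y)
    (e : SpanHom b k (id c Y).l (id c Y).r) (d : SpanHom a b P.l P.r) (ι : k ≅ b)
    (hι : ι.hom = e.rho.hom ≫ e.lam) :
    (P.pr (id c Y) e.cls d.cls).comp (rightUnitorHom P) =
      SpanHom.cls ⟨d.h, d.lam, ι ≪≫ d.rho⟩ := by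
  obtain ⟨f, hf, hf'⟩ := exists_pr_eq P (id c Y) e d
  rw [hf']
  exact hf.rightUnitor ι hι

theorem leftUnitor_hom_inv (P : Polynomial c X Y) :
    leftUnitorHom P ≫ leftUnitorInv P = 𝟙 _ := by
  obtain ⟨f, hf, hf'⟩ := exists_pr_eq (id c X) P (SpanHom.id P.l P.r) (SpanHom.toId P.l)
  have h := (hf.precomp (SpanHom.π₂ P.r ((id c X).square P))).pr_eq
  refine (congrArg ((leftUnitorHom P).comp ·) hf').trans (h.symm.trans ?_)
  exact (isPair_leftUnitor ((id c X).square P)).pr_eq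

theorem leftUnitor_inv_hom (P : Polynomial c X Y) :
    leftUnitorInv P ≫ leftUnitorHom P = 𝟙 P :=
  (pr_comp_leftUnitorHom P (SpanHom.id P.l P.r) (SpanHom.toId P.l)).trans
    (SpanHom.cls_eq (𝟙 _) (by simp) (by simp))

theorem rightUnitor_hom_inv (P : Polynomial c X Y) :
    rightUnitorHom P ≫ rightUnitorInv P = 𝟙 _ := by
  obtain ⟨f, hf, hf'⟩ := exists_pr_eq P (id c Y) (SpanHom.toId P.r) (SpanHom.id P.l P.r)
  have h := (hf.precomp (SpanHom.rightUnitorHom P.l (P.square (id c Y)))).pr_eq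
  refine (congrArg ((rightUnitorHom P).comp ·) hf').trans (h.symm.trans ?_)
  exact (isPair_rightUnitor (P.square (id c Y))).pr_eq

theorem rightUnitor_inv_hom (P : Polynomial c X Y) :
    rightUnitorInv P ≫ rightUnitorHom P = 𝟙 P :=
  (pr_comp_rightUnitorHom P (SpanHom.toId P.r) (SpanHom.id P.l P.r) (Iso.refl _) (by simp)).trans
    (SpanHom.cls_eq (𝟙 _) (by simp) (by simp))

theorem hcomp_leftUnitorHom {P Q : Polynomial c X Y} (f : P ⟶ Q) :
    hcomp (𝟙 (id c X)) f ≫ leftUnitorHom Q = leftUnitorHom P ≫ f := by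
  rw [← Category.id_comp (hcomp _ _), ← pr_id]
  change (((id c X).pr P _ _).comp (hcomp _ _)).comp _ = _
  rw [pr_comp_hcomp]
  obtain ⟨f⟩ := f
  refine (pr_comp_leftUnitorHom Q ((SpanHom.π₂ P.r ((id c X).square P)).comp f)
    ((SpanHom.π₁ (id c X).l ((id c X).square P)).comp (SpanHom.id _ _))).trans ?_
  refine SpanHom.cls_eq (𝟙 _) ?_ ?_
  · simp
  · simp

theorem hcomp_rightUnitorHom {P Q : Polynomial c X Y} (f : P ⟶ Q) :
    hcomp f (𝟙 (id c Y)) ≫ rightUnitorHom Q = rightUnitorHom P ≫ f := by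
  rw [← Category.id_comp (hcomp _ _), ← pr_id]
  change ((P.pr (id c Y) _ _).comp (hcomp _ _)).comp _ = _
  rw [pr_comp_hcomp]
  obtain ⟨f⟩ := f
  refine (pr_comp_rightUnitorHom Q ((SpanHom.π₂ (id c Y).r (P.square (id c Y))).comp
    (SpanHom.id _ _)) ((SpanHom.π₁ P.l (P.square (id c Y))).comp f)
    (P.square (id c Y)).iso ?_).trans ?_
  · simp
  · refine SpanHom.cls_eq (𝟙 _) ?_ ?_
    · simp
    · simp

theorem triangle (P : Polynomial c X Y) (Q : Polynomial c Y Z) :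
    assocHom P (id c Y) Q ≫ hcomp (𝟙 P) (leftUnitorHom Q) = hcomp (rightUnitorHom P) (𝟙 Q) := by
  let s₁ := P.square (id c Y)
  let s₁₂ := (P.comp (id c Y)).square Q
  let g : SpanHom (s₁₂.snd ≫ s₁.snd ≫ P.l) (s₁₂.snd ≫ s₁.fst ≫ 𝟙 Y) (s₁.snd ≫ P.l)
    (s₁.fst ≫ 𝟙 Y) := SpanHom.π₁ (P.comp (id c Y)).l s₁₂
  let e' := (g.left (s₁.snd ≫ P.r)).comp (SpanHom.π₂ (𝟙 Y) s₁)
  let d := (g.right (s₁.snd ≫ P.r)).comp (SpanHom.π₁ P.l s₁)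
  let ι : s₁₂.snd ≫ s₁.fst ≫ 𝟙 Y ≅ s₁₂.snd ≫ s₁.snd ≫ P.r := whiskerLeftIso s₁₂.snd s₁.iso
  have hg : g.cls = P.pr (id c Y) e'.cls d.cls := eq_pr P (id c Y) g
  have hι : ι.hom = e'.rho.hom ≫ e'.lam := by
    simp only [Iso.trans_hom, whiskerLeftIso_hom, Iso.symm_hom, Iso.refl_hom, e', g, ι]
    bicategory
  have hr := pr_comp_rightUnitorHom P e' d ι hι
  rw [← hg] at hr
  have hl := pr_comp_leftUnitorHom Q (SpanHom.π₂ Q.r s₁₂) e'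
  rw [← Category.id_comp (assocHom _ _ _), ← Category.id_comp (hcomp (rightUnitorHom P) _), ← pr_id]
  change (((P.comp (id c Y)).pr Q (SpanHom.π₂ Q.r s₁₂).cls g.cls).comp _).comp _ =
    ((P.comp (id c Y)).pr Q (SpanHom.π₂ Q.r s₁₂).cls g.cls).comp _
  rw [pr_comp_hcomp, hr, hg, pr_comp_assocHom, pr_comp_hcomp, hl,
    show SpanHom.Cls.comp d.cls (𝟙 P) = d.cls from SpanHom.Cls.comp_id d.cls,
    show SpanHom.Cls.comp (SpanHom.π₂ Q.r s₁₂).cls (𝟙 Q) = (SpanHom.π₂ Q.r s₁₂).cls from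
      SpanHom.Cls.comp_id _]
  obtain ⟨f, hf, hf'⟩ := exists_pr_eq P Q (SpanHom.π₂ Q.r s₁₂)
    (⟨d.h, d.lam, ι ≪≫ d.rho⟩ : SpanHom _ _ P.l P.r)
  refine Eq.trans ?_ hf'.symm
  have := (hf.change_middle (e'.rho.hom ≫ e'.lam) (d' := d) (𝟙 _) (by simp) (by
    rw [← hι]; simp)).pr_eq
  rw [← this]

end

end Polynomial


/-- The objects of the bicategory of polynomials in a calibrated bicategory. -/
structure Poly (c : Calibration M) where
  obj : M

namespace Poly

open CalibratedBicategory.Polynomial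

/-- The bicategory of polynomials in a calibrated bicategory. -/
noncomputable instance : Bicategory.{max v w, max u v} (Poly c) where
  Hom X Y := Polynomial c X.obj Y.obj
  id X := Polynomial.id c X.obj
  comp P Q := Polynomial.comp P Q
  homCategory X Y := inferInstanceAs (Category (Polynomial c X.obj Y.obj))
  whiskerLeft P _ _ g := hcomp (𝟙 P) g
  whiskerRight f Q := hcomp f (𝟙 Q)
  associator P Q R := ⟨assocHom P Q R, assocInv P Q R, assoc_hom_inv P Q R, assoc_inv_hom P Q R⟩
  leftUnitor P := ⟨leftUnitorHom P, leftUnitorInv P, leftUnitor_hom_inv P, leftUnitor_inv_hom P⟩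
  rightUnitor P :=
    ⟨rightUnitorHom P, rightUnitorInv P, rightUnitor_hom_inv P, rightUnitor_inv_hom P⟩
  whiskerLeft_id P Q := hcomp_id P Q
  whiskerLeft_comp P _ _ _ f g := by rw [← hcomp_comp, Category.comp_id]
  id_whiskerRight P Q := hcomp_id P Q
  comp_whiskerRight f g Q := by rw [← hcomp_comp, Category.comp_id]
  id_whiskerLeft f := by
    rw [← Category.assoc, ← hcomp_leftUnitorHom, Category.assoc, leftUnitor_hom_inv,
      Category.comp_id]
  whiskerRight_id f := by
    rw [← Category.assoc, ← hcomp_rightUnitorHom, Category.assoc, rightUnitor_hom_inv,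
      Category.comp_id]
  comp_whiskerLeft P Q _ _ f := by
    rw [← Category.assoc, ← hcomp_assocHom, Category.assoc, assoc_hom_inv, Category.comp_id,
      hcomp_id]
  whisker_assoc P _ _ f Q := by
    rw [← Category.assoc, ← hcomp_assocHom, Category.assoc, assoc_hom_inv, Category.comp_id]
  whiskerRight_comp f Q R := by
    rw [hcomp_assocHom, ← Category.assoc, assoc_inv_hom, Category.id_comp, hcomp_id]
  whisker_exchange f g := by
    rw [← hcomp_comp, ← hcomp_comp, Category.comp_id, Category.id_comp, Category.comp_id,
      Category.id_comp]
  pentagon P Q R U := pentagon P Q R U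
  triangle P Q := triangle P Q

end Poly

end Polynomials

section Representation

variable {M : Type u} [Bicategory.{w, v} M] {X Y S T : M}

/-- The right lifting of `u` through a right lifter `m`. -/
noncomputable def rif {m : S ⟶ X} (hm : IsRightLifter m) {K : M} (u : K ⟶ X) : K ⟶ S :=
  (hm u).choose.lift

/-- The universal 2-cell of the right lifting `rif m u`. -/
noncomputable def rifCounit {m : S ⟶ X} (hm : IsRightLifter m) {K : M} (u : K ⟶ X) :
    rif hm u ≫ m ⟶ u :=
  (hm u).choose.counit

/-- The 2-cell into `rif m u` determined by a 2-cell `m ∘ x ⟶ u`. -/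
noncomputable def rifDesc {m : S ⟶ X} (hm : IsRightLifter m) {K : M} {u : K ⟶ X} {x : K ⟶ S}
    (ξ : x ≫ m ⟶ u) : x ⟶ rif hm u :=
  (hm u).choose_spec.some.desc (RightLift.mk x ξ)

theorem rifDesc_counit {m : S ⟶ X} (hm : IsRightLifter m) {K : M} {u : K ⟶ X} {x : K ⟶ S}
    (ξ : x ≫ m ⟶ u) : rifDesc hm ξ ▷ m ≫ rifCounit hm u = ξ :=
  (hm u).choose_spec.some.fac (RightLift.mk x ξ)

theorem rif_hom_ext {m : S ⟶ X} (hm : IsRightLifter m) {K : M} {u : K ⟶ X} {x : K ⟶ S}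
    {τ τ' : x ⟶ rif hm u} (h : τ ▷ m ≫ rifCounit hm u = τ' ▷ m ≫ rifCounit hm u) : τ = τ' :=
  (hm u).choose_spec.some.hom_ext h

/-- The functor `rif(m, -) : M(K, X) ⥤ M(K, S)`. -/
noncomputable def rifFunctor {m : S ⟶ X} (hm : IsRightLifter m) (K : M) :
    (K ⟶ X) ⥤ (K ⟶ S) where
  obj u := rif hm u
  map f := rifDesc hm (rifCounit hm _ ≫ f)
  map_id u := rif_hom_ext hm (by rw [rifDesc_counit]; simp)
  map_comp f g := rif_hom_ext hm (by
    rw [rifDesc_counit, comp_whiskerRight, Category.assoc, rifDesc_counit,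
      ← Category.assoc, ← Category.assoc, rifDesc_counit])

/-- The adjunction between `M(K, m)` and `rif(m, -)`. -/
noncomputable def rifAdj {m : S ⟶ X} (hm : IsRightLifter m) (K : M) :
    postcomp K m ⊣ rifFunctor hm K :=
  Adjunction.mkOfHomEquiv
    { homEquiv := fun x u =>
        { toFun := fun ξ => rifDesc hm ξ
          invFun := fun τ => τ ▷ m ≫ rifCounit hm u
          left_inv := fun ξ => rifDesc_counit hm ξ
          right_inv := fun τ => rif_hom_ext hm (rifDesc_counit hm _) }
      homEquiv_naturality_left_symm := fun f g => by
        exact (congrArg (· ≫ rifCounit hm _) (comp_whiskerRight f g m)).trans (Category.assoc _ _ _)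
      homEquiv_naturality_right := fun f g => rif_hom_ext hm (by
        change rifDesc hm (f ≫ g) ▷ m ≫ _ = (rifDesc hm f ≫ rifDesc hm _) ▷ m ≫ _
        rw [rifDesc_counit, comp_whiskerRight, Category.assoc, rifDesc_counit, ← Category.assoc]
        exact congrArg (· ≫ g) (rifDesc_counit hm f).symm) }

/-- The natural transformation `M(K, m) ⟶ M(K, m')` given by a 2-cell `η : m ⟶ m'`. -/
def postcompMap (K : M) {m m' : S ⟶ X} (η : m ⟶ m') : postcomp K m ⟶ postcomp K m' :=
  (postcomposing K S X).map η

/-- The mate `M(K, h) ∘ rif(m, -) ⟶ rif(n, -)` of `M(K, λ) : M(K, n) ∘ M(K, h) ⟶ M(K, m)`. -/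
noncomputable def lamMate {m : S ⟶ X} (hm : IsRightLifter m) {n : T ⟶ X} (hn : IsRightLifter n)
    (K : M) {h : S ⟶ T} (lam : h ≫ n ⟶ m) :
    rifFunctor hm K ⋙ postcomp K h ⟶ rifFunctor hn K :=
  (mateEquiv (rifAdj hm K) (rifAdj hn K) (G := postcomp K h) (H := 𝟭 (K ⟶ X))
      (.mk _ _ _ _ ((associatorNatIsoLeft K h n).hom ≫ postcompMap K lam ≫
        (Functor.rightUnitor (postcomp K m)).inv))).natTrans ≫
    (Functor.leftUnitor (rifFunctor hn K)).hom

variable {c : Calibration M} (K : M)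

/-- The functor `M(K, p) ∘ rif(m, -)`. -/
noncomputable def repFunctor (P : Polynomial c X Y) : (K ⟶ X) ⥤ (K ⟶ Y) :=
  rifFunctor P.lifter K ⋙ postcomp K P.r

/-- The pasting of `M(K, ρ) : M(K, p) ⟶ M(K, q) ∘ M(K, h)` with the mate of `M(K, λ)`. -/
noncomputable def repTransf {P Q : Polynomial c X Y} (f : SpanHom P.l P.r Q.l Q.r) :
    repFunctor K P ⟶ repFunctor K Q :=
  Functor.whiskerLeft (rifFunctor P.lifter K)
      (postcompMap K f.rho.hom ≫ (associatorNatIsoLeft K f.h Q.r).inv) ≫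
    (Functor.associator _ _ _).inv ≫
    Functor.whiskerRight (lamMate P.lifter Q.lifter K f.lam) (postcomp K Q.r)

/-- The prefunctor underlying the representation of polynomials on the hom-categories
`M(K, X)`. -/
noncomputable def repPrefunctor (c : Calibration M) (K : M) : Prefunctor (Poly c) Cat.{w, v} where
  obj X := Cat.of (K ⟶ X.obj)
  map P := (repFunctor K P).toCatHom

end Representation

section Actegories

open MonoidalCategory MonoidalLeftAction Functor.LaxLeftLinear

/-- An *actegory* for a monoidal category `V`: a category on which `V` acts. -/
structure Actegory (V : Type u₁) [Category.{v₁} V] [MonoidalCategory V] where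
  carrier : Type u₂
  [category : Category.{v₂} carrier]
  [action : MonoidalLeftAction V carrier]

attribute [instance] Actegory.category Actegory.action

namespace Actegory

variable {V : Type u₁} [Category.{v₁} V] [MonoidalCategory V]

/-- A morphism of actegories: a functor `F` with coherent comparison morphisms
`a ⊙ F x ⟶ F (a ⊙ x)`. -/
structure Hom (A B : Actegory.{v₁, v₂, u₁, u₂} V) where
  functor : A.carrier ⥤ B.carrier
  [lax : functor.LaxLeftLinear V]

attribute [instance] Hom.lax

/-- A 2-cell of actegories: a natural transformation compatible with the comparison morphisms. -/
@[ext]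
structure Hom₂ {A B : Actegory.{v₁, v₂, u₁, u₂} V} (F G : Hom A B) where
  natTrans : F.functor ⟶ G.functor
  comm (a : V) (x : A.carrier) :
    a ⊴ₗ natTrans.app x ≫ μₗ G.functor a x = μₗ F.functor a x ≫ natTrans.app (a ⊙ₗ x)

/-- The identity morphism of an actegory. -/
def Hom.id (A : Actegory.{v₁, v₂, u₁, u₂} V) : Hom A A where
  functor := 𝟭 A.carrier
  lax :=
    { μₗ := fun a x => 𝟙 (a ⊙ₗ x)
      μₗ_naturality_left := fun f d => by simp
      μₗ_naturality_right := fun a _ _ f => by simp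
      μₗ_associativity := fun a b x => by simp
      μₗ_unitality := fun x => by simp }

/-- Composition of morphisms of actegories. -/
def Hom.comp {A B C : Actegory.{v₁, v₂, u₁, u₂} V} (F : Hom A B) (G : Hom B C) : Hom A C where
  functor := F.functor ⋙ G.functor
  lax :=
    { μₗ := fun a x => μₗ G.functor a (F.functor.obj x) ≫ G.functor.map (μₗ F.functor a x)
      μₗ_naturality_left := fun f d => by
        simp only [Functor.comp_obj, Functor.comp_map, Category.assoc]
        rw [μₗ_naturality_left_assoc, ← Functor.map_comp, ← Functor.map_comp, μₗ_naturality_left]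
      μₗ_naturality_right := fun a _ _ f => by
        simp only [Functor.comp_obj, Functor.comp_map, Category.assoc]
        rw [μₗ_naturality_right_assoc, ← Functor.map_comp, ← Functor.map_comp, μₗ_naturality_right]
      μₗ_associativity := fun a b x => by
        simp only [Functor.comp_obj, Functor.comp_map, Category.assoc,
          MonoidalLeftAction.actionHomRight_comp]
        rw [← Functor.map_comp, μₗ_associativity, Functor.map_comp, μₗ_associativity_assoc,
          Functor.map_comp, μₗ_naturality_right_assoc]
      μₗ_unitality := fun x => by
        simp only [Functor.comp_obj, Functor.comp_map, Category.assoc]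
        rw [← Functor.map_comp, ← μₗ_unitality, ← μₗ_unitality] }

/-- Morphisms of actegories and their 2-cells form a category. -/
instance (A B : Actegory.{v₁, v₂, u₁, u₂} V) : Category (Hom A B) where
  Hom F G := Hom₂ F G
  id F := ⟨𝟙 F.functor, fun a x => by simp⟩
  comp η θ := ⟨η.natTrans ≫ θ.natTrans, fun a x => by
    simp only [NatTrans.comp_app, MonoidalLeftAction.actionHomRight_comp, Category.assoc]
    rw [θ.comm, ← Category.assoc, η.comm, Category.assoc]⟩
  id_comp η := Hom₂.ext (Category.id_comp η.natTrans)
  comp_id η := Hom₂.ext (Category.comp_id η.natTrans)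
  assoc η θ κ := Hom₂.ext (Category.assoc η.natTrans θ.natTrans κ.natTrans)

/-- An invertible 2-cell of actegories. -/
def isoMk {A B : Actegory.{v₁, v₂, u₁, u₂} V} {F G : Hom A B} (e : F.functor ≅ G.functor)
    (h : ∀ (a : V) (x : A.carrier),
      a ⊴ₗ e.hom.app x ≫ μₗ G.functor a x = μₗ F.functor a x ≫ e.hom.app (a ⊙ₗ x)) : F ≅ G where
  hom := ⟨e.hom, h⟩
  inv := ⟨e.inv, fun a x => by
    rw [← cancel_mono (e.hom.app (a ⊙ₗ x)), Category.assoc, Category.assoc, ← h]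
    simp [← MonoidalLeftAction.actionHomRight_comp_assoc]⟩
  hom_inv_id := Hom₂.ext e.hom_inv_id
  inv_hom_id := Hom₂.ext e.inv_hom_id

variable {A B C : Actegory.{v₁, v₂, u₁, u₂} V}

/-- Left whiskering of a 2-cell of actegories. -/
def whiskerLeft (F : Hom A B) {G H : Hom B C} (η : G ⟶ H) : F.comp G ⟶ F.comp H :=
  Hom₂.mk (Functor.whiskerLeft F.functor η.natTrans) fun a x => by
    have h := η.comm a (F.functor.obj x)
    change _ ≫ μₗ H.functor a (F.functor.obj x) ≫ H.functor.map (μₗ F.functor a x) =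
      (μₗ G.functor a (F.functor.obj x) ≫ G.functor.map (μₗ F.functor a x)) ≫
        η.natTrans.app (F.functor.obj (a ⊙ₗ x))
    rw [Category.assoc, η.natTrans.naturality, ← reassoc_of% h]
    rfl

/-- Right whiskering of a 2-cell of actegories. -/
def whiskerRight {F G : Hom A B} (η : F ⟶ G) (H : Hom B C) : F.comp H ⟶ G.comp H :=
  Hom₂.mk (Functor.whiskerRight η.natTrans H.functor) fun a x => by
    have h := η.comm a x
    change a ⊴ₗ H.functor.map (η.natTrans.app x) ≫
        μₗ H.functor a (G.functor.obj x) ≫ H.functor.map (μₗ G.functor a x) =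
      (μₗ H.functor a (F.functor.obj x) ≫ H.functor.map (μₗ F.functor a x)) ≫
        H.functor.map (η.natTrans.app (a ⊙ₗ x))
    rw [μₗ_naturality_right_assoc, Category.assoc, ← Functor.map_comp, ← Functor.map_comp, h]

theorem hom_ext {F G : Hom A B} {η θ : F ⟶ G}
    (h : ∀ x : A.carrier, η.natTrans.app x = θ.natTrans.app x) : η = θ :=
  Hom₂.ext (NatTrans.ext (funext h))

/-- The 2-category of actegories for `V`. -/
instance : Bicategory (Actegory.{v₁, v₂, u₁, u₂} V) where
  Hom A B := Hom A B
  id A := Hom.id A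
  comp F G := Hom.comp F G
  whiskerLeft F _ _ η := whiskerLeft F η
  whiskerRight η H := whiskerRight η H
  associator F G H := isoMk (F := (F.comp G).comp H) (G := F.comp (G.comp H))
    (Functor.associator F.functor G.functor H.functor) fun a x => by
      change a ⊴ₗ 𝟙 _ ≫ (μₗ H.functor a (G.functor.obj (F.functor.obj x)) ≫
          H.functor.map (μₗ G.functor a (F.functor.obj x))) ≫
            H.functor.map (G.functor.map (μₗ F.functor a x)) =
        (μₗ H.functor a (G.functor.obj (F.functor.obj x)) ≫
          H.functor.map (μₗ G.functor a (F.functor.obj x) ≫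
            G.functor.map (μₗ F.functor a x))) ≫ 𝟙 _
      simp
  leftUnitor F := isoMk (F := (Hom.id _).comp F) (Functor.leftUnitor F.functor) fun a x => by
    change a ⊴ₗ 𝟙 _ ≫ μₗ F.functor a x = (μₗ F.functor a x ≫ F.functor.map (𝟙 _)) ≫ 𝟙 _
    simp
  rightUnitor F := isoMk (F := F.comp (Hom.id _)) (Functor.rightUnitor F.functor) fun a x => by
    change a ⊴ₗ 𝟙 _ ≫ μₗ F.functor a x = (𝟙 _ ≫ μₗ F.functor a x) ≫ 𝟙 _
    simp
  whiskerLeft_id F G := hom_ext fun x => rfl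
  whiskerLeft_comp F _ _ _ η θ := hom_ext fun x => rfl
  id_whiskerLeft η := by
    refine hom_ext fun x => ?_
    change (Hom₂.natTrans η).app x = 𝟙 _ ≫ (Hom₂.natTrans η).app x ≫ 𝟙 _
    simp
  comp_whiskerLeft F G _ _ η := by
    refine hom_ext fun x => ?_
    change (Hom₂.natTrans η).app (G.functor.obj (F.functor.obj x)) =
      𝟙 _ ≫ (Hom₂.natTrans η).app (G.functor.obj (F.functor.obj x)) ≫ 𝟙 _
    simp
  id_whiskerRight F G := hom_ext fun x => G.functor.map_id _
  comp_whiskerRight η θ G := hom_ext fun x => G.functor.map_comp _ _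
  whiskerRight_id η := by
    refine hom_ext fun x => ?_
    change (Hom₂.natTrans η).app x = 𝟙 _ ≫ (Hom₂.natTrans η).app x ≫ 𝟙 _
    simp
  whiskerRight_comp η G H := by
    refine hom_ext fun x => ?_
    change H.functor.map (G.functor.map ((Hom₂.natTrans η).app x)) =
      𝟙 _ ≫ H.functor.map (G.functor.map ((Hom₂.natTrans η).app x)) ≫ 𝟙 _
    simp
  whisker_assoc F _ _ η H := by
    refine hom_ext fun x => ?_
    change H.functor.map ((Hom₂.natTrans η).app (F.functor.obj x)) =
      𝟙 _ ≫ H.functor.map ((Hom₂.natTrans η).app (F.functor.obj x)) ≫ 𝟙 _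
    simp
  whisker_exchange η θ := hom_ext fun x =>
    ((Hom₂.natTrans θ).naturality ((Hom₂.natTrans η).app x)).symm
  pentagon F G H I := by
    refine hom_ext fun x => ?_
    change I.functor.map (𝟙 _) ≫ 𝟙 _ ≫ 𝟙 _ = 𝟙 _ ≫ 𝟙 _
    simp
  triangle F G := by
    refine hom_ext fun x => ?_
    change 𝟙 _ ≫ 𝟙 _ = G.functor.map (𝟙 _)
    simp

variable (V) in
/-- The forgetful pseudofunctor from actegories to categories. -/
def forget : Actegory.{v₁, v₂, u₁, u₂} V ⥤ᵖ Cat.{v₂, u₂} where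
  obj A := Cat.of A.carrier
  map F := F.functor.toCatHom
  map₂ η := (Hom₂.natTrans η).toCatHom₂
  map₂_id F := rfl
  map₂_comp η θ := rfl
  mapId A := Iso.refl _
  mapComp F G := Iso.refl _
  map₂_whisker_left F _ _ η := by
    refine Cat.Hom₂.ext (NatTrans.ext (funext fun x => ?_))
    change (Hom₂.natTrans η).app _ = 𝟙 _ ≫ (Hom₂.natTrans η).app _ ≫ 𝟙 _
    rw [Category.id_comp, Category.comp_id]
  map₂_whisker_right η H := by
    refine Cat.Hom₂.ext (NatTrans.ext (funext fun x => ?_))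
    change H.functor.map ((Hom₂.natTrans η).app x) =
      𝟙 _ ≫ H.functor.map ((Hom₂.natTrans η).app x) ≫ 𝟙 _
    rw [Category.id_comp, Category.comp_id]
  map₂_associator F G H := by
    refine Cat.Hom₂.ext (NatTrans.ext (funext fun x => ?_))
    change 𝟙 _ = 𝟙 _ ≫ H.functor.map (𝟙 _) ≫ 𝟙 _ ≫ 𝟙 _ ≫ 𝟙 _
    simp
  map₂_left_unitor {A B} F := by
    refine Cat.Hom₂.ext (NatTrans.ext (funext fun (x : A.carrier) => ?_))
    change 𝟙 (F.functor.obj x) = 𝟙 _ ≫ F.functor.map (𝟙 x) ≫ 𝟙 _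
    rw [F.functor.map_id, Category.id_comp, Category.id_comp]
  map₂_right_unitor F := by
    refine Cat.Hom₂.ext (NatTrans.ext (funext fun x => ?_))
    change 𝟙 _ = 𝟙 _ ≫ 𝟙 _ ≫ 𝟙 _
    simp

end Actegory

end Actegories

section RepAct

variable {M : Type u} [Bicategory.{w, v} M]

/-- The monoidal category `M(K, K)`, with `a ⊗ b = b ∘ a`, acts on `M(K, X)` by composition. -/
instance homAction (K X : M) : MonoidalCategory.MonoidalLeftAction (K ⟶ K) (K ⟶ X) where
  actionObj a u := a ≫ u
  actionHomLeft f u := f ▷ u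
  actionHomRight a _ _ g := a ◁ g
  actionAssocIso a b u := α_ a b u
  actionUnitIso u := λ_ u
  actionHom_def f g := rfl
  actionHomRight_id a u := Bicategory.whiskerLeft_id a u
  id_actionHomLeft a u := Bicategory.id_whiskerRight a u
  actionHom_comp f f' g g' := by
    change (f ≫ f') ▷ _ ≫ _ ◁ (g ≫ g') = (f ▷ _ ≫ _ ◁ g) ≫ f' ▷ _ ≫ _ ◁ g'
    rw [comp_whiskerRight, Bicategory.whiskerLeft_comp, Category.assoc, Category.assoc,
      whisker_exchange_assoc]
  actionAssocIso_hom_naturality f g h := by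
    change ((f ▷ _ ≫ _ ◁ g) ▷ _ ≫ (_ ≫ _) ◁ h) ≫ (α_ _ _ _).hom =
      (α_ _ _ _).hom ≫ f ▷ _ ≫ _ ◁ (g ▷ _ ≫ _ ◁ h)
    simp
  actionUnitIso_hom_naturality f := by
    change (λ_ _).hom ≫ f = 𝟙 _ ◁ f ≫ (λ_ _).hom
    simp
  whiskerLeft_actionHomLeft a _ _ f u := Bicategory.whisker_assoc a f u
  whiskerRight_actionHomLeft b f u := by
    change f ▷ b ▷ u = (α_ _ _ _).hom ≫ f ▷ (b ≫ u) ≫ (α_ _ _ _).inv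
    simp
  associator_actionHom a b c u := Bicategory.pentagon a b c u
  leftUnitor_actionHom a u := Bicategory.leftUnitor_whiskerRight a u
  rightUnitor_actionHom a u := (Bicategory.triangle a u).symm

/-- The comparison `(p ∘ rif(m, u)) ∘ a ⟶ p ∘ rif(m, u ∘ a)`: the 2-cell
`rif(m, u) ∘ a ⟶ rif(m, u ∘ a)` induced by the counit of `rif(m, u)`, whiskered with `p`. -/
noncomputable def strength {c : Calibration M} {X Y : M} (P : Polynomial c X Y) {K : M} (a : K ⟶ K)
    (u : K ⟶ X) : a ≫ rif P.lifter u ≫ P.r ⟶ rif P.lifter (a ≫ u) ≫ P.r :=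
  (α_ _ _ _).inv ≫
    rifDesc P.lifter ((α_ _ _ _).hom ≫ a ◁ rifCounit P.lifter u) ▷ P.r

/-- The prefunctor into actegories determined by a lax linear structure on each of the functors
`M(K, p) ∘ rif(m, -)`. -/
noncomputable def repAct (c : Calibration M) (K : M)
    (lax : ∀ {X Y : M} (P : Polynomial c X Y), (repFunctor K P).LaxLeftLinear (K ⟶ K)) :
    Prefunctor (Poly c) (Actegory.{w, w, v, v} (K ⟶ K)) where
  obj X := { carrier := K ⟶ X.obj }
  map P := { functor := repFunctor K P, lax := lax P }

end RepAct


end CalibratedBicategory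

open CalibratedBicategory

/-! The argument is a Yoneda-style calculus. For `u : K ⟶ X` and `b : K ⟶ Y`, a morphism of spans
from `(u, K, b)` to a polynomial `(m, S, p)` is some `h : K ⟶ S` with a 2-cell `m ∘ h ⟶ u` and an
isomorphism `b ≅ p ∘ h`. Transposing the first through the right lifting gives `h ⟶ rif(m, u)`, and
then a 2-cell `b ⟶ p ∘ rif(m, u)`. This is `eval`; it is constant on path components. Since `p` is a
groupoid fibration, every 2-cell `b ⟶ p ∘ rif(m, u)` arises in this way from exactly one path
component, so the value of the polynomial at `u` classifies spans into it. The proof uses only that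
`eval` is natural and sends the universal span `univ`, carried by `rif(m, u)` with its counit, to
the identity.

A 2-cell of polynomials therefore acts on values by composing with `univ` and evaluating (`clsApp`).
This agrees with the mate formula (`clsApp_cls`) and is functorial because span classes compose
associatively (`evalCls_comp`).

Horizontal composites are governed by `pr`, the pairing of spans through a bipullback, which is
defined for all spans out of `K` and not only for polynomials. The key lemma `eval_eq_compLift`
computes the value of a pairing: evaluate both factors, compose, and apply one fixed comparison
`compLift`, itself the value of the pairing of two universal spans. Its inverse `compDesc` comes
from the two projections. Each coherence law of the pseudofunctor is then the evaluation, at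
universal spans, of the law by which the corresponding constraint of `Poly c` acts on pairings.

The strength fits the same pattern: `a : K ⟶ K` acts on spans out of `K` by precomposition, and
evaluation turns this into whiskering by `a` followed by `strength` (`eval_act`). Precomposition
commutes with postcomposition and with pairing, so all 2-cells and comparisons are compatible with
strengths. The pseudofunctor is thus built directly into actegories, and the one into `Cat` is
obtained by forgetting. -/

namespace CalibratedBicategory

variable {M : Type u} [Bicategory.{w, v} M] {X Y Z W S T : M}

/-! ### Right liftings and mates. -/

section Rif

variable {m : S ⟶ X} (hm : IsRightLifter m) {K : M} {u : K ⟶ X} {x : K ⟶ S}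

@[simp]
theorem rifDesc_rifCounit : rifDesc hm (rifCounit hm u) = 𝟙 _ :=
  rif_hom_ext hm (by rw [rifDesc_counit]; simp)

theorem comp_rifDesc {y : K ⟶ S} (σ : y ⟶ x) (ξ : x ≫ m ⟶ u) :
    σ ≫ rifDesc hm ξ = rifDesc hm (σ ▷ m ≫ ξ) :=
  rif_hom_ext hm (by rw [comp_whiskerRight, Category.assoc, rifDesc_counit, rifDesc_counit])

theorem rifDesc_comp_rifDesc {u' : K ⟶ X} (ξ : x ≫ m ⟶ u) (v : u ⟶ u') :
    rifDesc hm ξ ≫ rifDesc hm (rifCounit hm u ≫ v) = rifDesc hm (ξ ≫ v) := by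
  rw [comp_rifDesc, ← Category.assoc, rifDesc_counit]

end Rif

/-- The mate of `M(K, λ)` is induced by pasting `λ` with the counit of `rif m u`. -/
theorem lamMate_app {m : S ⟶ X} (hm : IsRightLifter m) {n : T ⟶ X} (hn : IsRightLifter n)
    (K : M) {h : S ⟶ T} (lam : h ≫ n ⟶ m) (u : K ⟶ X) :
    (lamMate hm hn K lam).app u =
      rifDesc hn ((α_ _ _ _).hom ≫ rif hm u ◁ lam ≫ rifCounit hm u) := by
  have h₁ : ∀ x : K ⟶ T, (rifAdj hn K).unit.app x = rifDesc hn (𝟙 (x ≫ n)) := fun x => by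
    simp [rifAdj]
    rfl
  have h₂ : (rifAdj hm K).counit.app u = rifCounit hm u := by
    simp [rifAdj]
    exact (congrArg (· ≫ rifCounit hm u) (id_whiskerRight _ _)).trans (Category.id_comp _)
  -- The mate unfolds to three essential factors: the unit for `n`, then `rif(n, -)` applied to `λ`,
  -- then `rif(n, -)` applied to the counit for `m`. The identities are components of unitors and
  -- associators of functors. Each factor is a `rifDesc`, and `rifDesc_comp_rifDesc` merges them.
  have h₃ : (lamMate hm hn K lam).app u = (𝟙 _ ≫ (rifAdj hn K).unit.app (rif hm u ≫ h) ≫ 𝟙 _ ≫ 𝟙 _ ≫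
    rifDesc hn (rifCounit hn _ ≫ (α_ _ _ _).hom ≫ rif hm u ◁ lam ≫ 𝟙 _) ≫ 𝟙 _ ≫ 𝟙 _ ≫
    rifDesc hn (rifCounit hn _ ≫ (rifAdj hm K).counit.app u) ≫ 𝟙 _) ≫ 𝟙 _ := rfl
  refine Eq.trans (b := rifDesc hn (𝟙 _) ≫ (rifDesc hn (rifCounit hn ((rif hm u ≫ h) ≫ n) ≫
    (α_ _ _ _).hom ≫ rif hm u ◁ lam) ≫ rifDesc hn (rifCounit hn _ ≫ rifCounit hm u))) ?_ ?_
  · rw [h₃, h₁, h₂]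
    simp only [Category.id_comp, Category.comp_id]
    rfl
  · rw [← Category.assoc, rifDesc_comp_rifDesc, rifDesc_comp_rifDesc]
    simp

variable {c : Calibration M} {K : M}

/-! ### Values of a polynomial in terms of right liftings. -/

namespace Polynomial

/-- The value at `u` of the functor represented by a polynomial. -/
noncomputable abbrev val (P : Polynomial c X Y) (u : K ⟶ X) : K ⟶ Y := rif P.lifter u ≫ P.r

/-- The value at a 2-cell of the functor represented by a polynomial. -/
noncomputable def valMap (P : Polynomial c X Y) {u u' : K ⟶ X} (v : u ⟶ u') : P.val u ⟶ P.val u' :=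
  rifDesc P.lifter (rifCounit P.lifter u ≫ v) ▷ P.r

theorem valMap_id (P : Polynomial c X Y) (u : K ⟶ X) : P.valMap (𝟙 u) = 𝟙 _ := by
  simp [valMap]

theorem valMap_comp (P : Polynomial c X Y) {u u' u'' : K ⟶ X} (v : u ⟶ u') (v' : u' ⟶ u'') :
    P.valMap (v ≫ v') = P.valMap v ≫ P.valMap v' := by
  simp only [valMap]
  rw [← comp_whiskerRight, rifDesc_comp_rifDesc, Category.assoc]

/-- The components of the natural transformation given by a morphism of spans. -/
noncomputable def transfApp {P Q : Polynomial c X Y} (f : SpanHom P.l P.r Q.l Q.r) (u : K ⟶ X) :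
    P.val u ⟶ Q.val u :=
  rif P.lifter u ◁ f.rho.hom ≫ (α_ _ _ _).inv ≫
    rifDesc Q.lifter ((α_ _ _ _).hom ≫ rif P.lifter u ◁ f.lam ≫ rifCounit P.lifter u) ▷ Q.r

end Polynomial

/-- Removes adjunctions and mates from the problem: afterwards only the universal property of `rif`
is needed. -/
theorem repTransf_app {P Q : Polynomial c X Y} (f : SpanHom P.l P.r Q.l Q.r) (u : K ⟶ X) :
    (repTransf K f).app u = Polynomial.transfApp f u := by
  have h : (repTransf K f).app u = (rif P.lifter u ◁ f.rho.hom ≫ (α_ _ _ _).inv) ≫ 𝟙 _ ≫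
    Bicategory.whiskerRight ((lamMate P.lifter Q.lifter K f.lam).app u) Q.r := rfl
  rw [h, lamMate_app, Polynomial.transfApp]
  exact (Category.assoc _ _ _).trans (congrArg (_ ≫ ·) (congrArg (_ ≫ ·) (Category.id_comp _)))

/-! ### Evaluation of spans at a polynomial. -/

namespace Polynomial

variable {u : K ⟶ X} {b : K ⟶ Y}

/-- The 2-cell `b ⟶ p ∘ rif(m, u)` determined by a morphism of spans from `(u, K, b)` to a
polynomial `(m, S, p)`. -/
noncomputable def eval (P : Polynomial c X Y) (f : SpanHom u b P.l P.r) : b ⟶ P.val u :=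
  f.rho.hom ≫ rifDesc P.lifter f.lam ▷ P.r

/-- The two conditions on a cell `σ` say that the transposes of the `λ` components differ by `σ` and
that the `ρ` components differ by `p σ`, so `σ` cancels in the composite. -/
theorem eval_eq_of_cell (P : Polynomial c X Y) {f g : SpanHom u b P.l P.r}
    (κ : SpanHom.Cell f g) : P.eval f = P.eval g := by
  rw [eval, eval, ← κ.lam, ← κ.rho, ← comp_rifDesc, comp_whiskerRight, Category.assoc]

/-- The 2-cell `b ⟶ p ∘ rif(m, u)` determined by a path component of morphisms of spans. -/
noncomputable def evalCls (P : Polynomial c X Y) (f : SpanHom.Cls u b P.l P.r) : b ⟶ P.val u :=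
  Quot.lift P.eval (fun _ _ ⟨κ⟩ => P.eval_eq_of_cell κ) f

theorem evalCls_cls (P : Polynomial c X Y) (f : SpanHom u b P.l P.r) :
    P.evalCls f.cls = P.eval f := rfl

/-- The universal morphism of spans into a polynomial with left leg `u`. -/
noncomputable abbrev univ (P : Polynomial c X Y) (u : K ⟶ X) : SpanHom u (P.val u) P.l P.r :=
  ⟨rif P.lifter u, rifCounit P.lifter u, Iso.refl _⟩

theorem eval_univ (P : Polynomial c X Y) (u : K ⟶ X) : P.eval (P.univ u) = 𝟙 _ := by
  simp [eval]

theorem evalCls_univ (P : Polynomial c X Y) (u : K ⟶ X) : P.evalCls (P.univ u).cls = 𝟙 _ :=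
  P.eval_univ u

/-- Naturality of evaluation in the polynomial. By interchange the transpose of `f.lam` slides past
`g.rho` and `g.lam` until it meets the counit, where it becomes `f.lam` again. -/
theorem eval_comp {P Q : Polynomial c X Y} (f : SpanHom u b P.l P.r)
    (g : SpanHom P.l P.r Q.l Q.r) : Q.eval (f.comp g) = P.eval f ≫ transfApp g u := by
  rw [transfApp, eval, eval, Category.assoc, ← whisker_exchange_assoc,
    associator_inv_naturality_left_assoc, ← comp_whiskerRight, comp_rifDesc,
    associator_naturality_left_assoc, ← whisker_exchange_assoc, rifDesc_counit]
  simp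

/-- Naturality of evaluation in the left leg `u`. -/
theorem eval_push (P : Polynomial c X Y) (f : SpanHom u b P.l P.r) {u' : K ⟶ X} (v : u ⟶ u') :
    P.eval ⟨f.h, f.lam ≫ v, f.rho⟩ = P.eval f ≫ P.valMap v := by
  simp only [valMap, eval, Category.assoc]
  rw [← comp_whiskerRight, rifDesc_comp_rifDesc]

/-- The components of the natural transformation given by a 2-cell of polynomials. -/
noncomputable def clsApp {P Q : Polynomial c X Y} (f : P ⟶ Q) (u : K ⟶ X) : P.val u ⟶ Q.val u :=
  Q.evalCls ((P.univ u).cls.comp f)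

/-- Identifies the Yoneda description with the explicit pasting. As the left side sees only the path
component, this also gives independence of the representative. -/
theorem clsApp_cls {P Q : Polynomial c X Y} (f : SpanHom P.l P.r Q.l Q.r) (u : K ⟶ X) :
    clsApp (P := P) (Q := Q) f.cls u = transfApp f u := by
  rw [clsApp, SpanHom.cls_comp, evalCls_cls, eval_comp, eval_univ, Category.id_comp]

theorem evalCls_comp {P Q : Polynomial c X Y} (f : SpanHom.Cls u b P.l P.r) (g : P ⟶ Q) :
    Q.evalCls (f.comp g) = P.evalCls f ≫ clsApp g u := by
  obtain ⟨f⟩ := f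
  obtain ⟨g⟩ := g
  exact (eval_comp f g).trans (congrArg (P.eval f ≫ ·) (clsApp_cls g u).symm)

theorem clsApp_id (P : Polynomial c X Y) (u : K ⟶ X) : clsApp (𝟙 P) u = 𝟙 _ :=
  (congrArg P.evalCls (SpanHom.Cls.comp_id _)).trans (P.evalCls_univ u)

theorem clsApp_comp {P Q R : Polynomial c X Y} (f : P ⟶ Q) (g : Q ⟶ R) (u : K ⟶ X) :
    clsApp (f ≫ g) u = clsApp f u ≫ clsApp g u := by
  rw [clsApp, clsApp, ← evalCls_comp]
  exact congrArg R.evalCls (SpanHom.Cls.assoc _ _ _).symm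

/-! ### Comparison for composite polynomials. -/

section Comp

variable {k : K ⟶ Z} {P : Polynomial c X Y} {Q : Polynomial c Y Z}

variable (P Q) in
/-- The 2-cell `q p̃ ∘ rif(m ñ, u) ⟶ q ∘ rif(n, p ∘ rif(m, u))` given by the projections of a
composite polynomial. -/
noncomputable def compDesc (u : K ⟶ X) : (P.comp Q).val u ⟶ Q.val (P.val u) :=
  Q.eval ((((P.comp Q).univ u).left ((P.square Q).snd ≫ P.r)).comp (SpanHom.π₂ Q.r (P.square Q))) ≫
    Q.valMap (P.eval ((((P.comp Q).univ u).right ((P.square Q).snd ≫ P.r)).comp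
      (SpanHom.π₁ P.l (P.square Q))))

variable (P Q) in
/-- The 2-cell `q ∘ rif(n, p ∘ rif(m, u)) ⟶ q p̃ ∘ rif(m ñ, u)` given by pairing. -/
noncomputable def compLift (u : K ⟶ X) : Q.val (P.val u) ⟶ (P.comp Q).val u :=
  (P.comp Q).evalCls (P.pr Q (Q.univ (P.val u)).cls (P.univ u).cls)

theorem eval_comp_valMap_eval (e : SpanHom b k Q.l Q.r) (d : SpanHom u b P.l P.r) :
    Q.eval e ≫ Q.valMap (P.eval d) = e.rho.hom ≫
      rifDesc Q.lifter (e.lam ≫ d.rho.hom ≫ rifDesc P.lifter d.lam ▷ P.r) ▷ Q.r := by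
  rw [← eval_push]
  rfl

/-- `compDesc` is assembled from the two projections of the bipullback, and the projections of a
pairing recover `e` and `d` up to the 2-cells `τ` and `σ`; these are absorbed by the transposes. -/
theorem eval_comp_compDesc {f : SpanHom u k (P.comp Q).l (P.comp Q).r} {e : SpanHom b k Q.l Q.r}
    {d : SpanHom u b P.l P.r} (h : IsPair (P.square Q) f e d) :
    (P.comp Q).eval f ≫ compDesc P Q u = Q.eval e ≫ Q.valMap (P.eval d) := by
  let s := P.square Q
  -- `δ` is the part of `compDesc` before whiskering with `q`, for an arbitrary `h` into the
  -- bipullback. Letting `h` vary makes it natural (`hδ`), so the value at `rif` can be replaced by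
  -- the value at `f.h`.
  let δ : ∀ (h : K ⟶ s.pt), (h ≫ s.snd ≫ P.l ⟶ u) → (h ≫ s.fst ⟶ rif Q.lifter (P.val u)) :=
    fun h lam => rifDesc Q.lifter ((s.cmp h).hom ≫
      rifDesc P.lifter ((α_ h s.snd P.l).hom ≫ lam) ▷ P.r)
  have hδ : ∀ {h h' : K ⟶ s.pt} (σ : h ⟶ h') (lam : h' ≫ s.snd ≫ P.l ⟶ u),
      σ ▷ s.fst ≫ δ h' lam = δ h (σ ▷ _ ≫ lam) := by
    intro h h' σ lam
    simp only [δ]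
    rw [comp_rifDesc, ← Category.assoc, s.cmp_naturality, Category.assoc, ← comp_whiskerRight,
      comp_rifDesc, associator_naturality_left_assoc]
  have hc : compDesc P Q u = (α_ _ _ _).inv ≫ δ (rif (P.comp Q).lifter u)
      (rifCounit (P.comp Q).lifter u) ▷ Q.r := by
    rw [compDesc, eval_comp_valMap_eval]
    simp only [δ, IsoSquare.cmp_hom, s]
    congr 3
    · simp
    · simp
  obtain ⟨σ, τ, h₁, h₂, h₃⟩ := h
  rw [hc, eval_comp_valMap_eval, eval, h₃]
  simp only [Category.assoc]
  rw [associator_inv_naturality_left_assoc, ← comp_whiskerRight, hδ, rifDesc_counit,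
    Iso.hom_inv_id_assoc, ← comp_whiskerRight]
  simp only [δ]
  -- The form of `f.lam` exposes `σ`; together with `τ` and the square it forms exactly the left
  -- side of the pairing equation `h₁`.
  rw [h₂, Iso.hom_inv_id_assoc, ← comp_rifDesc, comp_whiskerRight σ,
    comp_rifDesc, reassoc_of% h₁]

/-- The main computation. Every pairing over `u` maps to the pairing `g` of the two universal spans,
by the bipullback property and the cartesianness of 2-cells over the groupoid fibration `p`;
evaluation then factors through that of `g`. -/
theorem eval_eq_compLift {f : SpanHom u k (P.comp Q).l (P.comp Q).r} {e : SpanHom b k Q.l Q.r}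
    {d : SpanHom u b P.l P.r} (h : IsPair (P.square Q) f e d) :
    (P.comp Q).eval f = Q.eval e ≫ Q.valMap (P.eval d) ≫ compLift P Q u := by
  obtain ⟨g, hg, hg'⟩ := exists_pr_eq P Q (Q.univ (P.val u)) (P.univ u)
  -- Moving `P.eval d` across the middle leg replaces `d` by the universal span, at the cost of
  -- composing it onto `e.lam`. Only the case of a universal second factor remains.
  have h' := h.change_middle (P.eval d) (d' := P.univ u) (rifDesc P.lifter d.lam)
    (rifDesc_counit _ _) (by simp [eval])
  rw [compLift, hg', evalCls_cls, ← Category.assoc, ← eval_push]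
  generalize he : (⟨e.h, e.lam ≫ P.eval d, e.rho⟩ : SpanHom (P.val u) k Q.l Q.r) = e' at *
  clear he h
  obtain ⟨σ, τ, h₁, h₂, h₃⟩ := h'
  obtain ⟨σ', τ', h₁', h₂', h₃'⟩ := hg
  -- `η : f.h ⟶ g.h` need not be invertible. Its first projection is the transpose of `e'.lam`, up
  -- to `τ` and `τ'`, and its second projection carries `σ'` to `σ`.
  obtain ⟨η, hη₁, hη₂⟩ := exists_hom_of_square (P.isBipullback_square Q)
    (c.isGroupoidFibration P.neat) σ' τ' h₁' (τ.inv ≫ rifDesc Q.lifter e'.lam) σ (by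
      have h₄ : rifDesc Q.lifter e'.lam ▷ Q.l ≫ rifCounit Q.lifter (P.val u) = e'.lam :=
        rifDesc_counit _ _
      simp only [Iso.refl_hom, Category.comp_id] at h₁ ⊢
      rw [comp_whiskerRight, Category.assoc, h₄, ← h₁, inv_hom_whiskerRight_assoc])
  have hf : f.lam = η ▷ _ ≫ g.lam := by
    rw [h₂, h₂', ← hη₂]
    simp
  rw [eval, eval, eval, hf, ← comp_rifDesc, h₃, h₃', comp_whiskerRight]
  simp only [Category.assoc]
  rw [← associator_naturality_left_assoc, hη₁]
  simp

theorem evalCls_pr (e : SpanHom.Cls b k Q.l Q.r) (d : SpanHom.Cls u b P.l P.r) :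
    (P.comp Q).evalCls (P.pr Q e d) =
      Q.evalCls e ≫ Q.valMap (P.evalCls d) ≫ compLift P Q u := by
  obtain ⟨e⟩ := e
  obtain ⟨d⟩ := d
  obtain ⟨f, hf, hf'⟩ := exists_pr_eq P Q e d
  exact (congrArg _ hf').trans (eval_eq_compLift hf)

variable (P Q) in
-- The universal span of the composite is itself the pairing of its two projections, and it
-- evaluates to the identity.
theorem compDesc_compLift (u : K ⟶ X) : compDesc P Q u ≫ compLift P Q u = 𝟙 _ := by
  have h := eval_eq_compLift (isPair_id.precomp ((P.comp Q).univ u) (s := P.square Q))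
  rw [compDesc, Category.assoc, ← h]
  exact (congrArg (P.comp Q).evalCls (SpanHom.Cls.comp_id ((P.comp Q).univ u).cls)).trans (eval_univ _ _)

variable (P Q) in
theorem compLift_compDesc (u : K ⟶ X) : compLift P Q u ≫ compDesc P Q u = 𝟙 _ := by
  obtain ⟨g, hg, hg'⟩ := exists_pr_eq P Q (Q.univ (P.val u)) (P.univ u)
  rw [compLift, hg', evalCls_cls, eval_comp_compDesc hg, eval_univ, eval_univ, valMap_id,
    Category.comp_id]

variable (P Q) in
-- Composing the left legs with `v` keeps a pairing a pairing, so the value of the pushed pairing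
-- can be computed in two ways.
theorem compLift_naturality {u u' : K ⟶ X} (v : u ⟶ u') :
    Q.valMap (P.valMap v) ≫ compLift P Q u' = compLift P Q u ≫ (P.comp Q).valMap v := by
  obtain ⟨g, hg, hg'⟩ := exists_pr_eq P Q (Q.univ (P.val u)) (P.univ u)
  have h : IsPair (P.square Q) ⟨g.h, g.lam ≫ v, g.rho⟩ (Q.univ (P.val u))
      ⟨(P.univ u).h, (P.univ u).lam ≫ v, (P.univ u).rho⟩ := by
    obtain ⟨σ, τ, h₁, h₂, h₃⟩ := hg
    exact ⟨σ, τ, h₁, by simp [h₂], h₃⟩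
  have h' := eval_eq_compLift h
  rw [eval_push, eval_push, eval_univ, eval_univ, Category.id_comp, Category.id_comp] at h'
  rw [← h', compLift, hg']
  rfl

end Comp

/-! ### Comparison for identity polynomials. -/

section Id

/-- The 2-cell from `u` to the value at `u` of the identity polynomial. -/
noncomputable def idLift (u : K ⟶ X) : u ⟶ (Polynomial.id c X).val u :=
  (Polynomial.id c X).eval ((SpanHom.toId u : SpanHom u u (𝟙 X) (𝟙 X)))

/-- The 2-cell from the value at `u` of the identity polynomial to `u`. -/
noncomputable def idDesc (u : K ⟶ X) : (Polynomial.id c X).val u ⟶ u :=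
  rifCounit (Polynomial.id c X).lifter u

theorem idLift_idDesc (u : K ⟶ X) : idLift (c := c) u ≫ idDesc u = 𝟙 u := by
  rw [idLift, eval, idDesc, Category.assoc, rifDesc_counit]
  simp

/-- A 2-cell into a right lifting through an identity is, up to the right unitor, the 2-cell it
transposes. Applied to the universal span, this shows that `idDesc` and `idLift` are mutually
inverse. -/
theorem eval_id {b : K ⟶ X} (f : SpanHom u b (𝟙 X) (𝟙 X)) :
    (Polynomial.id c X).eval f = f.rho.hom ≫ f.lam ≫ idLift u := by
  have h : rifDesc (Polynomial.id c X).lifter f.lam =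
      ((ρ_ f.h).inv ≫ f.lam) ≫ rifDesc (Polynomial.id c X).lifter (ρ_ u).hom := by
    rw [comp_rifDesc]
    simp
  rw [idLift, eval, eval, h]
  simp

theorem idLift_naturality {u u' : K ⟶ X} (v : u ⟶ u') :
    v ≫ idLift u' = idLift u ≫ (Polynomial.id c X).valMap v := by
  have h := eval_push (Polynomial.id c X) (SpanHom.toId u : SpanHom u u (𝟙 X) (𝟙 X)) v
  rw [eval_id] at h
  simpa [idLift] using h

theorem idDesc_idLift (u : K ⟶ X) : idDesc u ≫ idLift (c := c) u = 𝟙 _ := by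
  have h := eval_id (c := c) ((Polynomial.id c X).univ u)
  rw [eval_univ] at h
  exact (h.trans (Category.id_comp _)).symm

end Id

/-! ### Coherence of the comparisons. -/

section Coherence

theorem compLift_clsApp_hcomp {P P' : Polynomial c X Y} {Q Q' : Polynomial c Y Z} (f : P ⟶ P')
    (g : Q ⟶ Q') (u : K ⟶ X) :
    compLift P Q u ≫ clsApp (hcomp f g) u =
      clsApp g (P.val u) ≫ Q'.valMap (clsApp f u) ≫ compLift P' Q' u := by
  rw [compLift, ← evalCls_comp, pr_comp_hcomp, evalCls_pr]
  rfl

/-- Both sides are values of one threefold pairing of universal spans: the associator only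
rebrackets pairings, and `evalCls_pr` evaluates either bracketing. -/
theorem compLift_clsApp_assocHom (P : Polynomial c X Y) (Q : Polynomial c Y Z)
    (R : Polynomial c Z W) (u : K ⟶ X) :
    R.valMap (compLift P Q u) ≫ compLift (P.comp Q) R u ≫ clsApp (assocHom P Q R) u =
      compLift Q R (P.val u) ≫ compLift P (Q.comp R) u := by
  have h := congrArg (P.comp (Q.comp R)).evalCls (pr_comp_assocHom P Q R
    (R.univ (Q.val (P.val u))).cls (Q.univ (P.val u)).cls (P.univ u).cls)
  rw [evalCls_comp, evalCls_pr, evalCls_pr, evalCls_pr, evalCls_pr, evalCls_univ, evalCls_univ,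
    evalCls_univ, valMap_id, valMap_id, valMap_id] at h
  simpa using h

/-- The left unitor discards the `toId` factor of a pairing, leaving the universal span of `P`,
whose value is the identity. -/
theorem compLift_clsApp_leftUnitorHom (P : Polynomial c X Y) (u : K ⟶ X) :
    P.valMap (idLift u) ≫ compLift (Polynomial.id c X) P u ≫ clsApp (leftUnitorHom P) u = 𝟙 _ := by
  have h := congrArg P.evalCls (pr_comp_leftUnitorHom P (P.univ u) (SpanHom.toId u))
  rw [evalCls_comp, evalCls_pr, evalCls_univ] at h
  refine Eq.trans ?_ (h.trans ?_)
  · simp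
    rfl
  · rw [evalCls_cls]
    simp [eval]

theorem compLift_clsApp_rightUnitorHom (P : Polynomial c X Y) (u : K ⟶ X) :
    idLift (P.val u) ≫ compLift P (Polynomial.id c Y) u ≫ clsApp (rightUnitorHom P) u = 𝟙 _ := by
  have h := congrArg P.evalCls (pr_comp_rightUnitorHom P (SpanHom.toId (P.val u)) (P.univ u)
    (Iso.refl _) (by simp))
  rw [evalCls_comp, evalCls_pr, evalCls_univ, valMap_id] at h
  refine Eq.trans ?_ (h.trans ?_)
  · simp
    rfl
  · rw [evalCls_cls]
    simp [eval]

/-- This and the next three lemmas cancel the invertible comparisons, giving the equations in the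
shape of the pseudofunctor axioms. Both whiskering axioms are the cases where `f` or `g` is an
identity. -/
theorem clsApp_hcomp {P P' : Polynomial c X Y} {Q Q' : Polynomial c Y Z} (f : P ⟶ P')
    (g : Q ⟶ Q') (u : K ⟶ X) :
    clsApp (hcomp f g) u =
      compDesc P Q u ≫ clsApp g (P.val u) ≫ Q'.valMap (clsApp f u) ≫ compLift P' Q' u := by
  rw [← compLift_clsApp_hcomp, ← Category.assoc, compDesc_compLift, Category.id_comp]

theorem clsApp_assocHom (P : Polynomial c X Y) (Q : Polynomial c Y Z)
    (R : Polynomial c Z W) (u : K ⟶ X) :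
    clsApp (assocHom P Q R) u = compDesc (P.comp Q) R u ≫ R.valMap (compDesc P Q u) ≫
      compLift Q R (P.val u) ≫ compLift P (Q.comp R) u := by
  rw [← compLift_clsApp_assocHom, ← Category.assoc (R.valMap _), ← valMap_comp, compDesc_compLift,
    valMap_id, Category.id_comp, ← Category.assoc, compDesc_compLift, Category.id_comp]

theorem clsApp_leftUnitorHom (P : Polynomial c X Y) (u : K ⟶ X) :
    clsApp (leftUnitorHom P) u = compDesc (Polynomial.id c X) P u ≫ P.valMap (idDesc u) := by
  rw [← Category.comp_id (P.valMap (idDesc u)), ← compLift_clsApp_leftUnitorHom,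
    ← Category.assoc (P.valMap _), ← valMap_comp, idDesc_idLift, valMap_id, Category.id_comp,
    ← Category.assoc, compDesc_compLift, Category.id_comp]

theorem clsApp_rightUnitorHom (P : Polynomial c X Y) (u : K ⟶ X) :
    clsApp (rightUnitorHom P) u = compDesc P (Polynomial.id c Y) u ≫ idDesc (P.val u) := by
  rw [← Category.comp_id (idDesc (P.val u)), ← compLift_clsApp_rightUnitorHom,
    ← Category.assoc (idDesc _), idDesc_idLift, Category.id_comp,
    ← Category.assoc, compDesc_compLift, Category.id_comp]

end Coherence

/-! ### The action of endomorphisms of `K` and the strength. -/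

section Strength

variable {u : K ⟶ X} {b : K ⟶ Y} {k : K ⟶ Z}

/-- The action of `a : K ⟶ K` on a pair of morphisms out of `K`, as a morphism of spans. -/
abbrev act (a : K ⟶ K) (u : K ⟶ X) (b : K ⟶ Y) : SpanHom (a ≫ u) (a ≫ b) u b :=
  ⟨a, 𝟙 _, Iso.refl _⟩

/-- The strength measures how far evaluation is from commuting with precomposition by `a`:
transposing after whiskering with `a` differs from whiskering the transpose by the 2-cell that
defines `strength`. -/
theorem eval_act (P : Polynomial c X Y) (a : K ⟶ K) (f : SpanHom u b P.l P.r) :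
    P.eval ((act a u b).comp f) = a ◁ P.eval f ≫ strength P a u := by
  have h : (α_ a f.h P.l).hom ≫ a ◁ f.lam = (a ◁ rifDesc P.lifter f.lam) ▷ P.l ≫
      (α_ _ _ _).hom ≫ a ◁ rifCounit P.lifter u := by
    simp [← Bicategory.whiskerLeft_comp, rifDesc_counit]
  simp only [eval, strength]
  rw [Category.comp_id, h, ← comp_rifDesc]
  simp

theorem evalCls_act (P : Polynomial c X Y) (a : K ⟶ K) (f : SpanHom.Cls u b P.l P.r) :
    P.evalCls ((act a u b).cls.comp f) = a ◁ P.evalCls f ≫ strength P a u := by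
  obtain ⟨f⟩ := f
  exact P.eval_act a f

/-- Precomposition by `a` and postcomposition by `g` commute, by associativity of composition of
classes; evaluate both bracketings at the universal span. -/
theorem strength_clsApp {P Q : Polynomial c X Y} (g : P ⟶ Q) (a : K ⟶ K) (u : K ⟶ X) :
    a ◁ clsApp g u ≫ strength Q a u = strength P a u ≫ clsApp g (a ≫ u) := by
  have h := evalCls_comp ((act a u _).cls.comp (P.univ u).cls) g
  rw [SpanHom.Cls.assoc, evalCls_act, evalCls_act, evalCls_univ] at h
  simpa [clsApp] using h

/-- Pairings are stable under precomposition. This is what makes `compLift` compatible with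
strengths. -/
theorem act_pr (P : Polynomial c X Y) (Q : Polynomial c Y Z) (a : K ⟶ K)
    (e : SpanHom.Cls b k Q.l Q.r) (d : SpanHom.Cls u b P.l P.r) :
    (act a u k).cls.comp (P.pr Q e d) =
      P.pr Q ((act a b k).cls.comp e) ((act a u b).cls.comp d) := by
  obtain ⟨e⟩ := e
  obtain ⟨d⟩ := d
  obtain ⟨f, hf, hf'⟩ := exists_pr_eq P Q e d
  exact (congrArg _ hf').trans (hf.precomp (act a u k)).pr_eq.symm

theorem strength_compLift (P : Polynomial c X Y) (Q : Polynomial c Y Z) (a : K ⟶ K) (u : K ⟶ X) :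
    a ◁ compLift P Q u ≫ strength (P.comp Q) a u =
      strength Q a (P.val u) ≫ Q.valMap (strength P a u) ≫ compLift P Q (a ≫ u) := by
  rw [compLift, ← evalCls_act, act_pr, evalCls_pr, evalCls_act, evalCls_act, evalCls_univ,
    evalCls_univ]
  simp

theorem strength_idLift (a : K ⟶ K) (u : K ⟶ X) :
    a ◁ idLift u ≫ strength (Polynomial.id c X) a u = idLift (a ≫ u) := by
  rw [idLift, ← eval_act, eval_id]
  simp

theorem strength_naturality_left (P : Polynomial c X Y) {a a' : K ⟶ K} (f : a ⟶ a') (u : K ⟶ X) :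
    f ▷ P.val u ≫ strength P a' u = strength P a u ≫ P.valMap (f ▷ u) := by
  simp only [strength, valMap, Category.assoc]
  rw [← comp_whiskerRight, rifDesc_comp_rifDesc, associator_inv_naturality_left_assoc,
    ← comp_whiskerRight, comp_rifDesc, associator_naturality_left_assoc, Category.assoc,
    whisker_exchange]

theorem strength_naturality_right (P : Polynomial c X Y) (a : K ⟶ K) {u u' : K ⟶ X} (f : u ⟶ u') :
    a ◁ P.valMap f ≫ strength P a u' = strength P a u ≫ P.valMap (a ◁ f) := by
  simp only [strength, valMap, Category.assoc]
  rw [← comp_whiskerRight, rifDesc_comp_rifDesc, associator_inv_naturality_middle_assoc,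
    ← comp_whiskerRight, comp_rifDesc, associator_naturality_middle_assoc, Category.assoc,
    ← Bicategory.whiskerLeft_comp, rifDesc_counit, ← Bicategory.whiskerLeft_comp]

theorem strength_associativity (P : Polynomial c X Y) (a a' : K ⟶ K) (u : K ⟶ X) :
    strength P (a ≫ a') u ≫ P.valMap (α_ a a' u).hom =
      (α_ a a' (P.val u)).hom ≫ a ◁ strength P a' u ≫ strength P a (a' ≫ u) := by
  simp only [strength, valMap, Category.assoc, Bicategory.whiskerLeft_comp]
  rw [← comp_whiskerRight, rifDesc_comp_rifDesc, associator_inv_naturality_middle_assoc,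
    ← comp_whiskerRight, comp_rifDesc, associator_naturality_middle_assoc,
    ← Bicategory.whiskerLeft_comp, rifDesc_counit]
  -- The 2-cell inducing the strength of `a ≫ a'` is the one for two successive actions, preceded by
  -- an associator; `comp_rifDesc` then takes the associator out of the transpose.
  have h : (α_ (a ≫ a') (rif P.lifter u) P.l).hom ≫ (a ≫ a') ◁ rifCounit P.lifter u ≫
      (α_ a a' u).hom = (α_ a a' (rif P.lifter u)).hom ▷ P.l ≫
        (α_ a (a' ≫ rif P.lifter u) P.l).hom ≫
          a ◁ ((α_ a' (rif P.lifter u) P.l).hom ≫ a' ◁ rifCounit P.lifter u) := by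
    simp
  rw [Category.assoc, h, ← comp_rifDesc]
  simp

theorem strength_unitality (P : Polynomial c X Y) (u : K ⟶ X) :
    (λ_ (P.val u)).hom = strength P (𝟙 K) u ≫ P.valMap (λ_ u).hom := by
  simp only [strength, valMap, Category.assoc]
  have h : ((α_ (𝟙 K) (rif P.lifter u) P.l).hom ≫ 𝟙 K ◁ rifCounit P.lifter u) ≫ (λ_ u).hom =
      (λ_ _).hom ▷ P.l ≫ rifCounit P.lifter u := by
    simp
  rw [← comp_whiskerRight, rifDesc_comp_rifDesc, h, ← comp_rifDesc]
  simp

end Strength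

/-! ### Passage to natural transformations and actegories. -/

/-- The natural transformation given by a 2-cell of polynomials. -/
noncomputable def transf (K : M) {P Q : Polynomial c X Y} (f : P ⟶ Q) :
    repFunctor K P ⟶ repFunctor K Q :=
  Quot.lift (fun f => repTransf K f) (fun f g ⟨κ⟩ => by
    ext u
    -- Both components are `clsApp` of one and the same path component.
    rw [repTransf_app, repTransf_app, ← clsApp_cls, ← clsApp_cls,
      SpanHom.cls_eq κ.σ κ.lam κ.rho]) f

theorem transf_app {P Q : Polynomial c X Y} (f : P ⟶ Q) (u : K ⟶ X) :
    (transf K f).app u = clsApp f u := by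
  obtain ⟨f⟩ := f
  exact (repTransf_app f u).trans (clsApp_cls f u).symm

/-- The lax linear structure on the functor represented by a polynomial. -/
noncomputable abbrev laxLeftLinear (K : M) (P : Polynomial c X Y) :
    (repFunctor K P).LaxLeftLinear (K ⟶ K) where
  μₗ a u := strength P a u
  μₗ_naturality_left f u := strength_naturality_left P f u
  μₗ_naturality_right a _ _ f := strength_naturality_right P a f
  μₗ_associativity a a' u := strength_associativity P a a' u
  μₗ_unitality u := strength_unitality P u

/-- The hom-category `M(K, X)` as an actegory. -/
abbrev homActegory (K X : M) : Actegory.{w, w, v, v} (K ⟶ K) := { carrier := K ⟶ X }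

/-- The functor represented by a polynomial, as a morphism of actegories. -/
noncomputable abbrev actHom (K : M) (P : Polynomial c X Y) :
    homActegory K X ⟶ homActegory K Y :=
  Actegory.Hom.mk (repFunctor K P) (lax := laxLeftLinear K P)

/-- The 2-cell of actegories given by a 2-cell of polynomials. -/
noncomputable def actHom₂ (K : M) {P Q : Polynomial c X Y} (f : P ⟶ Q) :
    actHom K P ⟶ actHom K Q :=
  Actegory.Hom₂.mk (transf K f) fun a u => by
    rw [transf_app, transf_app]
    exact strength_clsApp f a u

/-- The comparison of the functor represented by a composite polynomial with the composite of the
functors. -/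
noncomputable def compIso (K : M) (P : Polynomial c X Y) (Q : Polynomial c Y Z) :
    actHom K P ≫ actHom K Q ≅ actHom K (P.comp Q) :=
  Actegory.isoMk (F := (actHom K P).comp (actHom K Q))
    (NatIso.ofComponents
      (fun u => ⟨compLift P Q u, compDesc P Q u, compLift_compDesc P Q u, compDesc_compLift P Q u⟩)
      fun v => compLift_naturality P Q v)
    -- Compatibility with strengths is checked only for `compLift`; for its inverse `compDesc` it is
    -- automatic.
    fun a u => (strength_compLift P Q a u).trans (Category.assoc _ _ _).symm

/-- The comparison of the functor represented by an identity polynomial with the identity. -/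
noncomputable def idIso (c : Calibration M) (K X : M) :
    𝟙 (homActegory K X) ≅ actHom K (Polynomial.id c X) :=
  Actegory.isoMk (F := Actegory.Hom.id (homActegory K X))
    (NatIso.ofComponents (fun u => ⟨idLift u, idDesc u, idLift_idDesc u, idDesc_idLift u⟩)
      fun v => idLift_naturality v)
    fun a u => (strength_idLift a u).trans (Category.id_comp _).symm

end Polynomial

/-! ### The pseudofunctors. -/

open CalibratedBicategory.Polynomial

/-- The representation of polynomials on the actegories `M(K, X)`. -/
noncomputable def repPseudofunctor (c : Calibration M) (K : M) :
    Poly c ⥤ᵖ Actegory.{w, w, v, v} (K ⟶ K) where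
  toPrefunctor := repAct c K (laxLeftLinear K)
  map₂ f := actHom₂ K f
  map₂_id P := Actegory.hom_ext fun u => (transf_app _ u).trans (clsApp_id P u)
  map₂_comp f g := Actegory.hom_ext fun u => (transf_app _ u).trans <|
    (clsApp_comp f g u).trans (congrArg₂ (· ≫ ·) (transf_app f u).symm (transf_app g u).symm)
  mapId X := (idIso c K X.obj).symm
  mapComp P Q := (compIso K P Q).symm
  map₂_whisker_left P Q R g := Actegory.hom_ext fun u => by
    refine (transf_app _ u).trans ((clsApp_hcomp (𝟙 P) g u).trans ?_)
    change _ = compDesc P Q u ≫ (transf K g).app (val P u) ≫ compLift P R u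
    rw [transf_app, clsApp_id, valMap_id, Category.id_comp]
    rfl
  map₂_whisker_right {_ _ _ P P'} f Q := Actegory.hom_ext fun u => by
    refine (transf_app _ u).trans ((clsApp_hcomp f (𝟙 Q) u).trans ?_)
    change _ = compDesc P Q u ≫ valMap Q ((transf K f).app u) ≫ compLift P' Q u
    rw [transf_app, clsApp_id, Category.id_comp]
    rfl
  map₂_associator P Q R := Actegory.hom_ext fun u => by
    refine (transf_app _ u).trans ((clsApp_assocHom P Q R u).trans ?_)
    -- The identity in the middle is the component of the associator of actegories.
    change _ = compDesc (Polynomial.comp P Q) R u ≫ valMap R (compDesc P Q u) ≫ 𝟙 _ ≫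
      compLift Q R (val P u) ≫ compLift P (Polynomial.comp Q R) u
    rw [Category.id_comp]
  map₂_left_unitor P := Actegory.hom_ext fun u => by
    refine (transf_app _ u).trans ((clsApp_leftUnitorHom P u).trans ?_)
    change _ = compDesc (Polynomial.id c _) P u ≫ valMap P (idDesc u) ≫ 𝟙 _
    rw [Category.comp_id]
  map₂_right_unitor P := Actegory.hom_ext fun u => by
    refine (transf_app _ u).trans ((clsApp_rightUnitorHom P u).trans ?_)
    change _ = compDesc P (Polynomial.id c _) u ≫ idDesc (val P u) ≫ 𝟙 _
    rw [Category.comp_id]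

end CalibratedBicategory

theorem mainTheorem4 {M : Type u} [Bicategory.{w, v} M] (c : Calibration M) (K : M) :
    ∃ φ : ∀ {X Y : Poly c} {P Q : X ⟶ Y}, (P ⟶ Q) →
        ((repPrefunctor c K).map P ⟶ (repPrefunctor c K).map Q),
      (∀ {X Y : M} {P Q : CalibratedBicategory.Polynomial c X Y} (f : SpanHom P.l P.r Q.l Q.r),
        φ (X := ⟨X⟩) (Y := ⟨Y⟩) (P := P) (Q := Q) f.cls = (repTransf K f).toCatHom₂) ∧
      ∃ H : Poly c ⥤ᵖ Cat.{w, v},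
        H.toPrelaxFunctorStruct = { toPrefunctor := repPrefunctor c K, map₂ := φ } ∧
        ∃ lax : ∀ {X Y : M} (P : CalibratedBicategory.Polynomial c X Y),
            (repFunctor K P).LaxLeftLinear (K ⟶ K),
          (∀ {X Y : M} (P : CalibratedBicategory.Polynomial c X Y) (a : K ⟶ K) (u : K ⟶ X),
            (lax P).μₗ a u = strength P a u) ∧
          ∃ H' : Poly c ⥤ᵖ Actegory.{w, w, v, v} (K ⟶ K),
            H'.toPrefunctor = repAct c K lax ∧ H'.comp (Actegory.forget (K ⟶ K)) = H :=
  -- The formula on representatives holds by `rfl`, since `transf` is a lift of `repTransf` to the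
  -- quotient. Taking the pseudofunctor into `Cat` to be the composite with `Actegory.forget` makes
  -- the lifting a strict equality.
  ⟨fun f => (Polynomial.transf K f).toCatHom₂, fun _ => rfl,
    (repPseudofunctor c K).comp (Actegory.forget (K ⟶ K)), rfl,
    Polynomial.laxLeftLinear K, fun _ _ _ => rfl, repPseudofunctor c K, rfl, rfl⟩
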